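/- Let $I\subset\mathbb R$ be an open interval and let $Y:I\times\mathbb R/2\pi\mathbb Z\to\mathbb C^2$ be a smooth Lagrangian immersion which is a cyclic surface of type I, i.e., up to a congruence $z\mapsto Uz+b$ with $U\in U(2)$, $b\in\mathbb C^2$, $$Y(s,t)=r(s)e^{i\phi(s)}(\cos t,\sin t)+\int_{s_0}^s e^{i\phi(u)}\bigl(W_1(u),W_2(u)\bigr)\,du ,$$ with $s_0\in I$ and smooth functions $r>0$, $\phi$, $W_1$, $W_2:I\to\mathbb R$. Suppose that $Y$ is Hamiltonian stationary, i.e. that its Lagrangian angle $\beta$, defined by $\det_{\mathbb C}(e_1,e_2)=e^{i\beta}$ for oriented orthonormal tangent frames $(e_1,e_2)$, is harmonic with respect to the metric induced by $Y$, and that $Y$ is non-planar, i.e. that its image is not contained in a real affine plane of $\mathbb C^2$. Then $Y$ is centered: all the circles $t\mapsto Y(s,t)$ have the same center. Moreover there are a constant $C\in\mathbb R$, an orientation-preserving smooth diffeomorphism $\psi$ from an open interval $J$ onto $I$, and functions $\rho>0$, $\varphi$, $\alpha$ on $J$ satisfying $$\rho'=\cos\alpha,\qquad \varphi'=\frac{\sin\alpha}{\rho},\qquad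 \alpha'=\frac{C-2\sin\alpha}{\rho}$$ (so that the plane curve $\rho e^{i\varphi}$ is parametrized by arc length), such that, up to a congruence $z\mapsto Uz+c$ with $U\in U(2)$, $c\in\mathbb C^2$, $$Y(\psi(\sigma),t)=\rho(\sigma)e^{i\varphi(\sigma)}(\cos t,\sin t)\qquad\text{for all }\sigma\in J,\ t\in\mathbb R/2\pi\mathbb Z .$$ -/

import Mathlib

open scoped ContDiff

noncomputable section

namespace CyclicLagrangian

/-- The space `ℂ²`. Its Euclidean metric is `inner ℝ`, the real part of the Hermitian product,
and its complex structure `J` is multiplication by `Complex.I`. -/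
abbrev C2 := EuclideanSpace ℂ (Fin 2)

/-- The complex determinant of two vectors of `ℂ²`. -/
def detC (x y : C2) : ℂ := x 0 * y 1 - x 1 * y 0

/-! Parametrized surfaces `Y : I × ℝ / 2πℤ → ℂ²`, where `I` is an open interval; a function of
`t ∈ ℝ / 2πℤ` is given as a `2π`-periodic function on `ℝ`. -/

/-- The partial derivative `∂Y/∂s`. -/
def dS {E : Type*} [NormedAddCommGroup E] [NormedSpace ℝ E] (Y : ℝ → ℝ → E) (s t : ℝ) : E :=
  deriv (fun σ => Y σ t) s

/-- The partial derivative `∂Y/∂t`. -/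
def dT {E : Type*} [NormedAddCommGroup E] [NormedSpace ℝ E] (Y : ℝ → ℝ → E) (s t : ℝ) : E :=
  deriv (fun τ => Y s τ) t

/-- `Y` is a smooth immersion of `I × ℝ / 2πℤ` into `ℂ²`. -/
def IsSmoothImmersion (I : Set ℝ) (Y : ℝ → ℝ → C2) : Prop :=
  ContDiffOn ℝ ∞ (fun z : ℝ × ℝ => Y z.1 z.2) (I ×ˢ Set.univ) ∧
  (∀ s ∈ I, ∀ t, Y s (t + 2 * Real.pi) = Y s t) ∧
  (∀ s ∈ I, ∀ t, LinearIndependent ℝ ![dS Y s t, dT Y s t])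

/-- `Y` is Lagrangian: `⟨Y_s, J Y_t⟩ = 0`. -/
def IsLagrangian (I : Set ℝ) (Y : ℝ → ℝ → C2) : Prop :=
  ∀ s ∈ I, ∀ t, inner ℝ (dS Y s t) (Complex.I • dT Y s t) = 0

/-- First fundamental form, coefficient `g_ss`. -/
def gE (Y : ℝ → ℝ → C2) (s t : ℝ) : ℝ := inner ℝ (dS Y s t) (dS Y s t)

/-- First fundamental form, coefficient `g_st`. -/
def gF (Y : ℝ → ℝ → C2) (s t : ℝ) : ℝ := inner ℝ (dS Y s t) (dT Y s t)

/-- First fundamental form, coefficient `g_tt`. -/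
def gG (Y : ℝ → ℝ → C2) (s t : ℝ) : ℝ := inner ℝ (dT Y s t) (dT Y s t)

/-- The area density `√(det g)`. -/
def areaDensity (Y : ℝ → ℝ → C2) (s t : ℝ) : ℝ :=
  Real.sqrt (gE Y s t * gG Y s t - gF Y s t ^ 2)

/-- The Laplace-Beltrami operator of the metric `g` induced by `Y`,
`Δf = (det g)^(-1/2) ∂ᵢ ((det g)^(1/2) gⁱʲ ∂ⱼ f)`; note that
`(det g)^(1/2) gˢˢ = g_tt / (det g)^(1/2)`, and similarly for the other coefficients. -/
def laplacian (Y : ℝ → ℝ → C2) (f : ℝ → ℝ → ℝ) (s t : ℝ) : ℝ :=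
  (dS (fun σ τ => (gG Y σ τ * dS f σ τ - gF Y σ τ * dT f σ τ) / areaDensity Y σ τ) s t +
    dT (fun σ τ => (gE Y σ τ * dT f σ τ - gF Y σ τ * dS f σ τ) / areaDensity Y σ τ) s t) /
  areaDensity Y s t

/-- `(e₁, e₂)` is a positively oriented orthonormal basis of the tangent plane of `Y` at `(s, t)`,
which is oriented by `(Y_s, Y_t)`. -/
def IsTangentFrame (Y : ℝ → ℝ → C2) (s t : ℝ) (e₁ e₂ : C2) : Prop :=
  inner ℝ e₁ e₁ = (1 : ℝ) ∧ inner ℝ e₂ e₂ = (1 : ℝ) ∧ inner ℝ e₁ e₂ = (0 : ℝ) ∧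
  ∃ a b c d : ℝ, 0 < a * d - b * c ∧
    e₁ = a • dS Y s t + b • dT Y s t ∧ e₂ = c • dS Y s t + d • dT Y s t

/-- `β` is a (smooth) Lagrangian angle function of `Y`: `det_ℂ (e₁, e₂) = e^{iβ}` for the oriented
orthonormal tangent frames. -/
def IsLagrangianAngle (I : Set ℝ) (Y : ℝ → ℝ → C2) (β : ℝ → ℝ → ℝ) : Prop :=
  ContDiffOn ℝ ∞ (fun z : ℝ × ℝ => β z.1 z.2) (I ×ˢ Set.univ) ∧
  ∀ s ∈ I, ∀ t, ∀ e₁ e₂ : C2, IsTangentFrame Y s t e₁ e₂ →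
    detC e₁ e₂ = Complex.exp ((β s t : ℂ) * Complex.I)

/-- `Y` is Hamiltonian stationary: its Lagrangian angle is harmonic for the induced metric. -/
def IsHamiltonianStationary (I : Set ℝ) (Y : ℝ → ℝ → C2) : Prop :=
  ∃ β : ℝ → ℝ → ℝ, IsLagrangianAngle I Y β ∧ ∀ s ∈ I, ∀ t, laplacian Y β s t = 0

/-- The point `r e^{iφ} (cos t, sin t)`. -/
def circlePoint (r φ t : ℝ) : C2 :=
  ((r : ℂ) * Complex.exp ((φ : ℂ) * Complex.I)) • !₂[(Real.cos t : ℂ), (Real.sin t : ℂ)]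

/-- The translation term `∫_{s₀}^s e^{iφ(u)} (W₁(u), W₂(u)) du`. -/
def translationTerm (φ W₁ W₂ : ℝ → ℝ) (s₀ s : ℝ) : C2 :=
  !₂[∫ u in s₀..s, Complex.exp ((φ u : ℂ) * Complex.I) * (W₁ u : ℂ),
     ∫ u in s₀..s, Complex.exp ((φ u : ℂ) * Complex.I) * (W₂ u : ℂ)]

/-- `Y` is a cyclic parametrization of type I: up to a congruence `z ↦ U z + b` of `ℂ²` with
`U` unitary, `Y(s,t) = r(s) e^{iφ(s)} (cos t, sin t) + ∫_{s₀}^s e^{iφ(u)} (W₁(u), W₂(u)) du`. -/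
def IsTypeI (I : Set ℝ) (Y : ℝ → ℝ → C2) : Prop :=
  ∃ (U : C2 ≃ₗᵢ[ℂ] C2) (b : C2) (s₀ : ℝ) (r φ W₁ W₂ : ℝ → ℝ),
    s₀ ∈ I ∧ ContDiffOn ℝ ∞ r I ∧ ContDiffOn ℝ ∞ φ I ∧
    ContDiffOn ℝ ∞ W₁ I ∧ ContDiffOn ℝ ∞ W₂ I ∧ (∀ s ∈ I, 0 < r s) ∧
    ∀ s ∈ I, ∀ t, Y s t = U (circlePoint (r s) (φ s) t + translationTerm φ W₁ W₂ s₀ s) + b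

/-- The image of `Y` lies in a real affine plane of `ℂ²`. -/
def IsPlanar (I : Set ℝ) (Y : ℝ → ℝ → C2) : Prop :=
  ∃ P : AffineSubspace ℝ C2, Module.finrank ℝ P.direction = 2 ∧ ∀ s ∈ I, ∀ t, Y s t ∈ P

/-- `Y` is centered: the curves `t ↦ Y(s,t)` are round circles with one common center. -/
def IsCentered (I : Set ℝ) (Y : ℝ → ℝ → C2) : Prop :=
  ∃ c : C2, ∀ s ∈ I, ∃ (ρ : ℝ) (e₁ e₂ : C2), 0 < ρ ∧
    inner ℝ e₁ e₁ = (1 : ℝ) ∧ inner ℝ e₂ e₂ = (1 : ℝ) ∧ inner ℝ e₁ e₂ = (0 : ℝ) ∧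
    ∀ t, Y s t = c + ρ • (Real.cos t • e₁ + Real.sin t • e₂)

/-- After a change of the parameter `s` by an orientation preserving diffeomorphism `ψ : J → I`,
and up to a congruence `z ↦ U z + c` of `ℂ²` with `U` unitary, `Y` is the centered type I surface
`r e^{iφ} (cos t, sin t)`, where `r' = cos α`, `α' = (C - 2 sin α) / r` for a real constant `C`.
The equations for `r'` and `φ'` together say that the curve `γ = r e^{iφ}` is parametrized by
arc length with `γ' = e^{iθ}`, `θ = φ + α`. -/
def IsCenteredExample (I : Set ℝ) (Y : ℝ → ℝ → C2) : Prop :=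
  ∃ (C : ℝ) (J : Set ℝ) (ψ r φ α : ℝ → ℝ) (U : C2 ≃ₗᵢ[ℂ] C2) (c : C2),
    IsOpen J ∧ J.OrdConnected ∧ ContDiffOn ℝ ∞ ψ J ∧ Set.BijOn ψ J I ∧
    (∀ s ∈ J, 0 < deriv ψ s ∧ 0 < r s ∧
      HasDerivAt r (Real.cos (α s)) s ∧
      HasDerivAt φ (Real.sin (α s) / r s) s ∧
      HasDerivAt α ((C - 2 * Real.sin (α s)) / r s) s) ∧
    ∀ s ∈ J, ∀ t, Y (ψ s) t = U (circlePoint (r s) (φ s) t) + c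

end CyclicLagrangian

end

noncomputable section

namespace CyclicLagrangian

/-! Write `u = (cos t, sin t)`, `w = W · u`, `v = W · u^⊥`, `a = r' + w`, `b = r φ'` and `A² = a² +
b²`. Then `Y_s = e^{iφ}((a + ib) u + v u^⊥)` and `Y_t = e^{iφ} r u^⊥`, so the area density is `r A`
and `β = 2φ + arg (a + ib) + const`. The flux density of `β` through the circles is `N / A³` with `N
= fluxNum`, and `Δβ = 0` becomes `defect = 0`: for fixed `s`, a polynomial identity in `w`, `v` on
the circle `w² + v² = |W|²`.

Such an identity persists on the complexified circle (`eq_zero_of_forall_rotated`). Suppose `b ≠ 0`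
and `W ≠ 0` at some `s`. At the complex points where `a = ib`, that is `A² = 0`, the defect
collapses to `3i N²`, so `N` vanishes there; this forces `N = b A²` for all `t`
(`fluxNum_eq_of_defect`). The identity holds on a neighbourhood of `s`; differentiating it and
returning to `defect = 0` gives a second identity, and the two are incompatible at special complex
points (`false_of_fluxNum_eq`). Hence `b W = 0` everywhere (`IsChart.translation_eq_zero`).

Consequently the flux at `t = 0` is a constant `C`. If `W ≠ 0` somewhere, then `b = 0` nearby and `C
= 0`; zero flux is a homogeneous linear ODE for `b / A`, so `b` vanishes identically, `φ` is
constant and `Y` is planar. In the non-planar case therefore `W = 0` and all centers agree. In an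
arc length parameter of `r e^{iφ}`, with `α = arg (a + ib)`, the equation `N = C A³` is the ODE for
`α`. -/

/-- A function of two complex variables that vanishes on the real unit circle vanishes on the
complex affine conic `x² + y² = 1`. -/
lemma eq_zero_of_forall_cos_sin (F : ℂ → ℂ → ℂ)
    (hF : Differentiable ℂ (fun z : ℂ × ℂ => F z.1 z.2))
    (h : ∀ t : ℝ, F (Real.cos t : ℂ) (Real.sin t : ℂ) = 0)
    {x y : ℂ} (hxy : x ^ 2 + y ^ 2 = 1) : F x y = 0 := by
  have hd : Differentiable ℂ (fun z : ℂ => F (Complex.cos z) (Complex.sin z)) :=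
    hF.comp (Complex.differentiable_cos.prodMk Complex.differentiable_sin)
  have han : AnalyticOnNhd ℂ (fun z : ℂ => F (Complex.cos z) (Complex.sin z)) Set.univ :=
    fun z _ => hd.analyticAt z
  have hseq : Filter.Tendsto (fun n : ℕ => (((1 : ℝ) / ((n : ℝ) + 1) : ℝ) : ℂ)) Filter.atTop
      (nhdsWithin 0 {0}ᶜ) := by
    refine tendsto_nhdsWithin_iff.2 ⟨?_, Filter.Eventually.of_forall fun n => ?_⟩
    · have := (Complex.continuous_ofReal.tendsto 0).comp
        (tendsto_one_div_add_atTop_nhds_zero_nat (𝕜 := ℝ))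
      simpa [Function.comp_def] using this
    · have : (1 : ℝ) / ((n : ℝ) + 1) ≠ 0 := by positivity
      exact Complex.ofReal_ne_zero.2 this
  have hfreq : ∃ᶠ z in nhdsWithin (0 : ℂ) {0}ᶜ, F (Complex.cos z) (Complex.sin z) = 0 := by
    refine hseq.frequently (Filter.Frequently.of_forall fun n => ?_)
    have := h ((1 : ℝ) / ((n : ℝ) + 1))
    rwa [Complex.ofReal_cos, Complex.ofReal_sin] at this
  have hzero := han.eqOn_zero_of_preconnected_of_frequently_eq_zero isPreconnected_univ
    (Set.mem_univ 0) hfreq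
  -- Every complex point of the conic is `(cos z, ± sin z)`; the sign is absorbed by `z ↦ -z`.
  obtain ⟨z, rfl⟩ := Complex.cos_surjective x
  have hs : (y - Complex.sin z) * (y + Complex.sin z) = 0 := by
    linear_combination hxy - Complex.sin_sq_add_cos_sq z
  rcases mul_eq_zero.1 hs with h1 | h1
  · rw [sub_eq_zero.1 h1]; exact hzero (Set.mem_univ z)
  · have := hzero (Set.mem_univ (-z))
    rw [eq_neg_of_add_eq_zero_left h1]
    simpa using this

/-! ### The harmonicity equation as a polynomial identity on a complex conic. -/

section Algebra

variable {R : Type*} [CommRing R]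

/-- The numerator of the flux of the Lagrangian angle through the circles `s = const`. -/
def fluxNum (r b b' a a' v : R) : R :=
  2 * b * (a ^ 2 + b ^ 2) + r * (a * b' - b * a') + b * v ^ 2

/-- The `s`-derivative of `fluxNum`. -/
def fluxNumS (r r' b b' b'' a a' a'' v v' : R) : R :=
  2 * b' * (a ^ 2 + b ^ 2) + 4 * b * (a * a' + b * b') + r' * (a * b' - b * a') +
    r * (a * b'' - b * a'') + b' * v ^ 2 + 2 * b * v * v'

/-- The `t`-derivative of `fluxNum`. -/
def fluxNumT (r b b' w a v v' : R) : R :=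
  4 * b * a * v + r * (v * b' - b * v') - 2 * b * v * w

/-- The Laplacian of the Lagrangian angle, up to a positive factor. -/
def defect (r r' b b' b'' w a a' a'' v v' : R) : R :=
  r * (fluxNumS r r' b b' b'' a a' a'' v v' * (a ^ 2 + b ^ 2) -
      3 * fluxNum r b b' a a' v * (a * a' + b * b')) +
    w * fluxNum r b b' a a' v * (a ^ 2 + b ^ 2) - v * fluxNumT r b b' w a v v' * (a ^ 2 + b ^ 2) +
    3 * fluxNum r b b' a a' v * a * v ^ 2 + b * w * (a ^ 2 + b ^ 2) ^ 2 +
    b * a * v ^ 2 * (a ^ 2 + b ^ 2)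

end Algebra

/-- A polynomial identity in `W · u`, `W · u^⊥` along the unit circle `u` extends to the complex
points of the circle. -/
lemma eq_zero_of_forall_rotated {W₁ W₂ : ℝ} (hK : W₁ ^ 2 + W₂ ^ 2 ≠ 0) (F : ℂ → ℂ → ℂ)
    (hF : Differentiable ℂ (fun z : ℂ × ℂ => F z.1 z.2))
    (h : ∀ t : ℝ, F (W₁ * Real.cos t + W₂ * Real.sin t : ℝ)
      (W₂ * Real.cos t - W₁ * Real.sin t : ℝ) = 0)
    {p q : ℂ} (hpq : p ^ 2 + q ^ 2 = ((W₁ ^ 2 + W₂ ^ 2 : ℝ) : ℂ)) : F p q = 0 := by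
  have hK' : ((W₁ : ℂ) ^ 2 + (W₂ : ℂ) ^ 2) ≠ 0 := by exact_mod_cast hK
  have hpq' : p ^ 2 + q ^ 2 = (W₁ : ℂ) ^ 2 + (W₂ : ℂ) ^ 2 := by rw [hpq]; push_cast; ring
  have key := eq_zero_of_forall_cos_sin
    (fun x y => F (W₁ * x + W₂ * y) (W₂ * x - W₁ * y))
    (hF.comp (f := fun z : ℂ × ℂ => ((W₁ * z.1 + W₂ * z.2 : ℂ), (W₂ * z.1 - W₁ * z.2 : ℂ)))
      (by fun_prop))
    (fun t => by have := h t; push_cast at this ⊢; exact this)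
    (x := (W₁ * p + W₂ * q) / ((W₁ : ℂ) ^ 2 + (W₂ : ℂ) ^ 2))
    (y := (W₂ * p - W₁ * q) / ((W₁ : ℂ) ^ 2 + (W₂ : ℂ) ^ 2))
    (by
      field_simp
      linear_combination ((W₁ : ℂ) ^ 2 + (W₂ : ℂ) ^ 2) * hpq')
  have e1 : (W₁ : ℂ) * ((W₁ * p + W₂ * q) / ((W₁ : ℂ) ^ 2 + (W₂ : ℂ) ^ 2)) +
      W₂ * ((W₂ * p - W₁ * q) / ((W₁ : ℂ) ^ 2 + (W₂ : ℂ) ^ 2)) = p := by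
    field_simp; ring
  have e2 : (W₂ : ℂ) * ((W₁ * p + W₂ * q) / ((W₁ : ℂ) ^ 2 + (W₂ : ℂ) ^ 2)) -
      W₁ * ((W₂ * p - W₁ * q) / ((W₁ : ℂ) ^ 2 + (W₂ : ℂ) ^ 2)) = q := by
    field_simp; ring
  simpa only [e1, e2] using key

/-- If `W ≠ 0`, any vector is a combination of `W` and its rotation. -/
lemma exists_components {W₁ W₂ : ℝ} (hK : W₁ ^ 2 + W₂ ^ 2 ≠ 0) (V₁ V₂ : ℝ) :
    ∃ l m : ℝ, ∀ x y : ℝ,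
      V₁ * x + V₂ * y = l * (W₁ * x + W₂ * y) + m * (W₂ * x - W₁ * y) ∧
      V₂ * x - V₁ * y = l * (W₂ * x - W₁ * y) - m * (W₁ * x + W₂ * y) := by
  refine ⟨(V₁ * W₁ + V₂ * W₂) / (W₁ ^ 2 + W₂ ^ 2), (V₁ * W₂ - V₂ * W₁) / (W₁ ^ 2 + W₂ ^ 2),
    fun x y => ⟨?_, ?_⟩⟩ <;> (field_simp; ring)

/-- Where `b ≠ 0` and `W ≠ 0`, harmonicity forces the flux to be `b / A`. -/
lemma fluxNum_eq_of_defect {r r' r'' r''' b b' b'' W₁ W₂ V₁ V₂ Z₁ Z₂ : ℝ} (hr : 0 < r) (hb : b ≠ 0)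
    (hK : W₁ ^ 2 + W₂ ^ 2 ≠ 0)
    (h : ∀ t : ℝ, defect r r' b b' b'' (W₁ * Real.cos t + W₂ * Real.sin t)
      (r' + (W₁ * Real.cos t + W₂ * Real.sin t)) (r'' + (V₁ * Real.cos t + V₂ * Real.sin t))
      (r''' + (Z₁ * Real.cos t + Z₂ * Real.sin t)) (W₂ * Real.cos t - W₁ * Real.sin t)
      (V₂ * Real.cos t - V₁ * Real.sin t) = 0) (t : ℝ) :
    fluxNum r b b' (r' + (W₁ * Real.cos t + W₂ * Real.sin t))
      (r'' + (V₁ * Real.cos t + V₂ * Real.sin t)) (W₂ * Real.cos t - W₁ * Real.sin t) =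
      b * ((r' + (W₁ * Real.cos t + W₂ * Real.sin t)) ^ 2 + b ^ 2) := by
  -- Expressing `W'` and `W''` through `W` and its rotation makes the defect a polynomial in `p = w`
  -- and `q = v` alone.
  obtain ⟨l, m, hV⟩ := exists_components hK V₁ V₂
  obtain ⟨l₂, m₂, hZ⟩ := exists_components hK Z₁ Z₂
  have hc : ∀ p q : ℂ, p ^ 2 + q ^ 2 = ((W₁ ^ 2 + W₂ ^ 2 : ℝ) : ℂ) →
      defect (r : ℂ) r' b b' b'' p (r' + p) (r'' + (l * p + m * q)) (r''' + (l₂ * p + m₂ * q)) q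
        (l * q - m * p) = 0 := by
    intro p q hpq
    refine eq_zero_of_forall_rotated hK (fun p q => defect (r : ℂ) r' b b' b'' p (r' + p)
      (r'' + (l * p + m * q)) (r''' + (l₂ * p + m₂ * q)) q (l * q - m * p)) ?_ ?_ hpq
    · simp only [defect, fluxNum, fluxNumS, fluxNumT]
      fun_prop
    · intro t
      have := h t
      rw [(hV _ _).1, (hV _ _).2, (hZ _ _).1] at this
      have h2 := congrArg (fun x : ℝ => (x : ℂ)) this
      simp only [defect, fluxNum, fluxNumS, fluxNumT] at h2 ⊢
      push_cast at h2 ⊢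
      exact h2
  have hbC : (b : ℂ) ≠ 0 := by exact_mod_cast hb
  have hrC : (r : ℂ) ≠ 0 := by exact_mod_cast hr.ne'
  -- The value of `w` at which `a = ib`, hence `a² + b² = 0`.
  set p : ℂ := Complex.I * b - r' with hp
  have hI : Complex.I ^ 2 = -1 := Complex.I_sq
  have hN : ∀ q : ℂ, p ^ 2 + q ^ 2 = ((W₁ ^ 2 + W₂ ^ 2 : ℝ) : ℂ) →
      fluxNum (r : ℂ) b b' (Complex.I * b) (r'' + (l * p + m * q)) q = 0 := by
    intro q hpq
    have h1 := hc p q hpq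
    have ha : (r' : ℂ) + p = Complex.I * b := by rw [hp]; ring
    rw [ha] at h1
    have h2 : (Complex.I * b) ^ 2 + (b : ℂ) ^ 2 = 0 := by rw [mul_pow, hI]; ring
    -- All terms with a factor `a² + b²` drop out. What remains is `3 N (a v² - r (a a' + b b'))`,
    -- and for `a = ib` the bracket is `i N`.
    have h3 : (3 * Complex.I) * fluxNum (r : ℂ) b b' (Complex.I * b) (r'' + (l * p + m * q)) q ^ 2
        = 0 := by
      simp only [defect, h2] at h1
      simp only [fluxNum, h2] at h1 ⊢
      set as := (r'' : ℂ) + (l * p + m * q)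
      linear_combination h1 + 3 * b ^ 2 * r * b' * (r * Complex.I * b' - r * as + q ^ 2) * hI
    have : (3 * Complex.I) ≠ 0 := by simp
    simpa [this] using h3
  obtain ⟨q, hq⟩ : ∃ q : ℂ, p ^ 2 + q ^ 2 = ((W₁ ^ 2 + W₂ ^ 2 : ℝ) : ℂ) := by
    obtain ⟨q, hq⟩ := IsAlgClosed.exists_pow_nat_eq (((W₁ ^ 2 + W₂ ^ 2 : ℝ) : ℂ) - p ^ 2)
      (n := 2) (by norm_num)
    exact ⟨q, by rw [hq]; ring⟩
  -- Both points of the conic over `p` are available; subtracting the two equations isolates the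
  -- coefficient `m` of the odd term in `q`.
  have hplus := hN q hq
  have hminus := hN (-q) (by rw [neg_sq]; exact hq)
  have hq2 : q ^ 2 = (W₁ ^ 2 + W₂ ^ 2 + b ^ 2 - r' ^ 2 : ℝ) + (2 * b * r' : ℝ) * Complex.I := by
    push_cast at hq ⊢
    rw [hp] at hq
    linear_combination hq - (b : ℂ) ^ 2 * hI
  have hKpos : 0 < W₁ ^ 2 + W₂ ^ 2 := lt_of_le_of_ne (by positivity) (Ne.symm hK)
  have hq0 : q ≠ 0 := by
    rintro rfl
    have hre := congrArg Complex.re hq2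
    have him := congrArg Complex.im hq2
    simp only [ne_eq, OfNat.ofNat_ne_zero, not_false_eq_true, zero_pow, Complex.zero_re,
      Complex.zero_im, Complex.add_re, Complex.add_im, Complex.ofReal_re, Complex.ofReal_im,
      Complex.mul_re, Complex.mul_im, Complex.I_re, Complex.I_im] at hre him
    have hr' : r' = 0 := by
      have : b * r' = 0 := by linarith
      exact (mul_eq_zero.1 this).resolve_left hb
    subst hr'
    nlinarith [sq_nonneg b]
  have hm : m = 0 := by
    simp only [fluxNum] at hplus hminus
    have : (2 * r * b * q : ℂ) * m = 0 := by linear_combination hminus - hplus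
    have h2 : (2 * r * b * q : ℂ) ≠ 0 := by simp [hrC, hbC, hq0]
    exact_mod_cast (mul_eq_zero.1 this).resolve_left h2
  subst hm
  -- Once `m = 0` and `v² = |W|² - w²`, the difference `N - b A²` is affine in `w` with real
  -- coefficients. It vanishes at the nonreal number `w = ib - r'`, so both coefficients vanish;
  -- they are extracted from the real and imaginary parts.
  have hfin : ((r * (-(b * (r'' - l * r'))) + b * (W₁ ^ 2 + W₂ ^ 2 + b ^ 2 - r' ^ 2) : ℝ) : ℂ) +
      ((r * (b * b' - b * l * b) + 2 * b ^ 2 * r' : ℝ) : ℂ) * Complex.I = 0 := by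
    simp only [fluxNum] at hplus
    rw [hq2, hp] at hplus
    push_cast at hplus ⊢
    linear_combination hplus - 2 * (b : ℂ) ^ 3 * hI
  have hre := congrArg Complex.re hfin
  have him := congrArg Complex.im hfin
  simp only [Complex.zero_re,
      Complex.zero_im, Complex.add_re, Complex.add_im, Complex.ofReal_re, Complex.ofReal_im,
      Complex.mul_re, Complex.mul_im, Complex.I_re, Complex.I_im] at hre him
  have him' : r * (b' - l * b) + 2 * b * r' = 0 := by
    have : b * (r * (b' - l * b) + 2 * b * r') = 0 := by linarith
    exact (mul_eq_zero.1 this).resolve_left hb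
  rw [(hV _ _).1]
  have hwv : (W₁ * Real.cos t + W₂ * Real.sin t) ^ 2 + (W₂ * Real.cos t - W₁ * Real.sin t) ^ 2 =
      W₁ ^ 2 + W₂ ^ 2 := by
    linear_combination (W₁ ^ 2 + W₂ ^ 2) * Real.sin_sq_add_cos_sq t
  set w := W₁ * Real.cos t + W₂ * Real.sin t
  set v := W₂ * Real.cos t - W₁ * Real.sin t
  simp only [fluxNum]
  linear_combination b * hwv + (w + r') * him' + hre

/-- The identities satisfied where `b ≠ 0` and `W ≠ 0` are incompatible. -/
lemma false_of_fluxNum_eq {r r' r'' b b' W₁ W₂ V₁ V₂ : ℝ} (hb : b ≠ 0)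
    (hK : W₁ ^ 2 + W₂ ^ 2 ≠ 0)
    (h₁ : ∀ t : ℝ, fluxNum r b b' (r' + (W₁ * Real.cos t + W₂ * Real.sin t))
      (r'' + (V₁ * Real.cos t + V₂ * Real.sin t)) (W₂ * Real.cos t - W₁ * Real.sin t) =
      b * ((r' + (W₁ * Real.cos t + W₂ * Real.sin t)) ^ 2 + b ^ 2))
    (h₂ : ∀ t : ℝ, r * (r' + (W₁ * Real.cos t + W₂ * Real.sin t)) *
      (b' * (r' + (W₁ * Real.cos t + W₂ * Real.sin t)) -
        b * (r'' + (V₁ * Real.cos t + V₂ * Real.sin t))) =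
      -2 * b * ((W₁ * Real.cos t + W₂ * Real.sin t) *
        ((r' + (W₁ * Real.cos t + W₂ * Real.sin t)) ^ 2 + b ^ 2) +
        (r' + (W₁ * Real.cos t + W₂ * Real.sin t)) *
        (W₂ * Real.cos t - W₁ * Real.sin t) ^ 2)) : False := by
  obtain ⟨l, m, hV⟩ := exists_components hK V₁ V₂
  have hc₁ : ∀ p q : ℂ, p ^ 2 + q ^ 2 = ((W₁ ^ 2 + W₂ ^ 2 : ℝ) : ℂ) →
      fluxNum (r : ℂ) b b' (r' + p) (r'' + (l * p + m * q)) q -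
        b * ((r' + p) ^ 2 + b ^ 2) = 0 := by
    intro p q hpq
    refine eq_zero_of_forall_rotated hK (fun p q => fluxNum (r : ℂ) b b' (r' + p)
      (r'' + (l * p + m * q)) q - b * ((r' + p) ^ 2 + b ^ 2)) ?_ ?_ hpq
    · simp only [fluxNum]
      fun_prop
    · intro t
      have := sub_eq_zero.2 (h₁ t)
      rw [(hV _ _).1] at this
      have h2 := congrArg (fun x : ℝ => (x : ℂ)) this
      simp only [fluxNum] at h2 ⊢
      push_cast at h2 ⊢
      exact h2
  have hc₂ : ∀ p q : ℂ, p ^ 2 + q ^ 2 = ((W₁ ^ 2 + W₂ ^ 2 : ℝ) : ℂ) →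
      r * (r' + p) * (b' * (r' + p) - b * (r'' + (l * p + m * q))) -
        -2 * b * (p * ((r' + p) ^ 2 + b ^ 2) + (r' + p) * q ^ 2) = 0 := by
    intro p q hpq
    refine eq_zero_of_forall_rotated hK (fun p q =>
      r * (r' + p) * (b' * (r' + p) - b * (r'' + (l * p + m * q))) -
        -2 * b * (p * ((r' + p) ^ 2 + b ^ 2) + (r' + p) * q ^ 2)) ?_ ?_ hpq
    · fun_prop
    · intro t
      have := sub_eq_zero.2 (h₂ t)
      rw [(hV _ _).1] at this
      have h2 := congrArg (fun x : ℝ => (x : ℂ)) this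
      push_cast at h2 ⊢
      exact h2
  have hsq : ∀ z : ℂ, ∃ q : ℂ, q ^ 2 = z := fun z => IsAlgClosed.exists_pow_nat_eq z (by norm_num)
  -- At a complex point with `a = 0`, only `2 b³ w` survives in the second identity, and there `w =
  -- -r'`.
  have hr' : r' = 0 := by
    obtain ⟨q, hq⟩ := hsq (((W₁ ^ 2 + W₂ ^ 2 : ℝ) : ℂ) - (-(r' : ℂ)) ^ 2)
    have h3 := hc₂ (-r') q (by rw [hq]; ring)
    have h4 : (2 * b ^ 3 : ℂ) * r' = 0 := by linear_combination -h3
    exact_mod_cast (mul_eq_zero.1 h4).resolve_left (by simp [hb])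
  subst hr'
  -- The points with `v = 0`, namely `w = ± p`. Combining both identities there eliminates `r''`,
  -- `b'` and `l` and leaves `b p (p² + b²) = 0`, although `p² + b² = |W|² + b² > 0`.
  obtain ⟨p, hp⟩ := hsq ((W₁ ^ 2 + W₂ ^ 2 : ℝ) : ℂ)
  have hp0 : p ≠ 0 := by
    rintro rfl
    rw [zero_pow two_ne_zero] at hp
    exact hK (by exact_mod_cast hp.symm)
  have e₁ := hc₁ p 0 (by rw [hp]; ring)
  have e₂ := hc₁ (-p) 0 (by rw [neg_sq, hp]; ring)
  have e₃ := hc₂ p 0 (by rw [hp]; ring)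
  have e₄ := hc₂ (-p) 0 (by rw [neg_sq, hp]; ring)
  simp only [fluxNum] at e₁ e₂
  have h5 : (b * p) * (p ^ 2 + (b : ℂ) ^ 2) = 0 := by
    push_cast at *
    linear_combination (e₃ - e₄) / 2 - p * (e₁ + e₂) / 2
  have h6 : p ^ 2 + (b : ℂ) ^ 2 = 0 := (mul_eq_zero.1 h5).resolve_left (by simp [hb, hp0])
  rw [hp] at h6
  have h7 : W₁ ^ 2 + W₂ ^ 2 + b ^ 2 = 0 := by exact_mod_cast h6
  have : 0 < b ^ 2 := by positivity
  nlinarith [sq_nonneg W₁, sq_nonneg W₂]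

/-! ### Calculus on an open interval -/

lemma hasDerivAt_of_contDiffOn {I : Set ℝ} (hI : IsOpen I) {f : ℝ → ℝ} (hf : ContDiffOn ℝ ∞ f I)
    {s : ℝ} (hs : s ∈ I) : HasDerivAt f (deriv f s) s :=
  ((hf.contDiffAt (hI.mem_nhds hs)).differentiableAt (by simp)).hasDerivAt

lemma contDiffOn_deriv {I : Set ℝ} (hI : IsOpen I) {f : ℝ → ℝ} (hf : ContDiffOn ℝ ∞ f I) :
    ContDiffOn ℝ ∞ (deriv f) I :=
  ((contDiffOn_infty_iff_deriv_of_isOpen hI).1 hf).2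

lemma hasDerivAt_integral {E : Type*} [NormedAddCommGroup E] [NormedSpace ℝ E] [CompleteSpace E]
    {I : Set ℝ} (hI : IsOpen I) (hc : I.OrdConnected) {f : ℝ → E} (hf : ContinuousOn f I)
    {s₀ s : ℝ} (hs₀ : s₀ ∈ I) (hs : s ∈ I) :
    HasDerivAt (fun x => ∫ u in s₀..x, f u) (f s) s :=
  intervalIntegral.integral_hasDerivAt_right
    ((hf.mono (hc.uIcc_subset hs₀ hs)).intervalIntegrable)
    (hf.stronglyMeasurableAtFilter hI s hs) (hf.continuousAt (hI.mem_nhds hs))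

lemma eq_of_forall_hasDerivAt_zero {I : Set ℝ} (hI : IsOpen I) (hc : I.OrdConnected) {f : ℝ → ℝ}
    (hf : ∀ s ∈ I, HasDerivAt f 0 s) {x y : ℝ} (hx : x ∈ I) (hy : y ∈ I) : f x = f y :=
  hI.is_const_of_deriv_eq_zero hc.isPreconnected
    (fun s hs => (hf s hs).differentiableAt.differentiableWithinAt)
    (fun s hs => (hf s hs).deriv) hx hy

/-- The derivative of the argument of a plane curve. -/
lemma deriv_angle {f g θ A : ℝ → ℝ} {f' g' θ' x : ℝ} {d : ℂ} (hf : HasDerivAt f f' x)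
    (hg : HasDerivAt g g' x) (hθ : HasDerivAt θ θ' x) (hA : A x ≠ 0)
    (h : ∀ᶠ y in nhds x, Complex.exp (θ y * Complex.I) * A y = d * (f y + g y * Complex.I)) :
    θ' * (f x ^ 2 + g x ^ 2) = f x * g' - g x * f' := by
  -- This function equals the real-valued `A` near `x`, so its derivative is real. No
  -- differentiability of `A` is needed.
  have hH : HasDerivAt (fun y => d * (f y + g y * Complex.I) * Complex.exp (-(θ y * Complex.I)))
      (d * (f' + g' * Complex.I) * Complex.exp (-(θ x * Complex.I)) +
        d * (f x + g x * Complex.I) *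
          (Complex.exp (-(θ x * Complex.I)) * (-(θ' * Complex.I)))) x :=
    ((hf.ofReal_comp.add (hg.ofReal_comp.mul_const _)).const_mul d).mul
      (hθ.ofReal_comp.mul_const Complex.I).neg.cexp
  have hcancel : ∀ y, Complex.exp (θ y * Complex.I) * Complex.exp (-(θ y * Complex.I)) = 1 := by
    intro y; rw [← Complex.exp_add]; simp
  have hreal : ∀ᶠ y in nhds x, d * (f y + g y * Complex.I) * Complex.exp (-(θ y * Complex.I)) =
      A y := by
    filter_upwards [h] with y hy
    rw [← hy]
    linear_combination (A y : ℂ) * hcancel y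
  have him : HasDerivAt (fun _ : ℝ => (0 : ℝ)) _ x :=
    ((Complex.imCLM.hasFDerivAt.comp_hasDerivAt x hH)).congr_of_eventuallyEq
      (by filter_upwards [hreal] with y hy; simp [hy])
  have h0 := him.unique (hasDerivAt_const x (0 : ℝ))
  set e := Complex.exp (-(θ x * Complex.I)) with he
  obtain ⟨k, hk⟩ : ∃ k : ℝ, d * (f' + g' * Complex.I) * e +
        d * (f x + g x * Complex.I) * (e * (-(θ' * Complex.I))) = k := by
    refine ⟨_, (Complex.conj_eq_iff_re.1 (Complex.conj_eq_iff_im.2 ?_)).symm⟩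
    simpa using h0
  have hx := hreal.self_of_nhds
  have hmul : (k : ℂ) * (f x + g x * Complex.I) =
      A x * ((f' + g' * Complex.I) - θ' * Complex.I * (f x + g x * Complex.I)) := by
    rw [← hk, ← hx]; ring
  have hre := congrArg Complex.re hmul
  have him := congrArg Complex.im hmul
  simp at hre him
  have : A x * (θ' * (f x ^ 2 + g x ^ 2) - (f x * g' - g x * f')) = 0 := by
    linear_combination f x * him - g x * hre
  exact sub_eq_zero.1 ((mul_eq_zero.1 this).resolve_left hA)

/-! ### Unitary frames -/

/-- The image of `(z₁, z₂)` under `U`. -/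
def comb (U : C2 ≃ₗᵢ[ℂ] C2) (z₁ z₂ : ℂ) : C2 := z₁ • U !₂[1, 0] + z₂ • U !₂[0, 1]

lemma comb_eq (U : C2 ≃ₗᵢ[ℂ] C2) (z₁ z₂ : ℂ) : comb U z₁ z₂ = U !₂[z₁, z₂] := by
  rw [comb, ← map_smul, ← map_smul, ← map_add]
  congr 1
  ext i; fin_cases i <;> simp

lemma inner_map (U : C2 ≃ₗᵢ[ℂ] C2) (x y : C2) : inner ℝ (U x) (U y) = inner ℝ x y := by
  rw [real_inner_eq_norm_add_mul_self_sub_norm_mul_self_sub_norm_mul_self_div_two,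
    real_inner_eq_norm_add_mul_self_sub_norm_mul_self_sub_norm_mul_self_div_two, ← map_add]
  simp only [LinearIsometryEquiv.norm_map]

/-- Neither `U` nor a common phase affects the metric, so the factor `e^{iφ}` disappears from the
first fundamental form. -/
lemma inner_comb (U : C2 ≃ₗᵢ[ℂ] C2) {e : ℂ} (he : ‖e‖ = 1) (z₁ z₂ w₁ w₂ : ℂ) :
    inner ℝ (comb U (e * z₁) (e * z₂)) (comb U (e * w₁) (e * w₂)) =
      z₁.re * w₁.re + z₁.im * w₁.im + (z₂.re * w₂.re + z₂.im * w₂.im) := by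
  have h : e.re ^ 2 + e.im ^ 2 = 1 := by
    have := Complex.sq_norm e
    rw [he, Complex.normSq_apply] at this
    linarith
  rw [comb_eq, comb_eq, inner_map]
  simp [PiLp.inner_apply, Fin.sum_univ_two, Complex.inner]
  linear_combination (z₁.re * w₁.re + z₁.im * w₁.im + (z₂.re * w₂.re + z₂.im * w₂.im)) * h

lemma detC_comb (U : C2 ≃ₗᵢ[ℂ] C2) (z₁ z₂ w₁ w₂ : ℂ) :
    detC (comb U z₁ z₂) (comb U w₁ w₂) =
      detC (U !₂[1, 0]) (U !₂[0, 1]) * (z₁ * w₂ - z₂ * w₁) := by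
  simp [detC, comb]; ring

lemma smul_comb (U : C2 ≃ₗᵢ[ℂ] C2) (c : ℝ) (z₁ z₂ : ℂ) :
    c • comb U z₁ z₂ = comb U (c * z₁) (c * z₂) := by
  rw [← Complex.coe_smul]
  simp only [comb, smul_add, smul_smul]

lemma comb_add (U : C2 ≃ₗᵢ[ℂ] C2) (z₁ z₂ w₁ w₂ : ℂ) :
    comb U z₁ z₂ + comb U w₁ w₂ = comb U (z₁ + w₁) (z₂ + w₂) := by
  simp only [comb, add_smul]; abel

/-! ### The data of a surface of type I -/

/-- `W · (cos t, sin t)`. -/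
def radial (W₁ W₂ : ℝ → ℝ) (s t : ℝ) : ℝ := W₁ s * Real.cos t + W₂ s * Real.sin t

/-- `W · (-sin t, cos t)`. -/
def tang (W₁ W₂ : ℝ → ℝ) (s t : ℝ) : ℝ := W₂ s * Real.cos t - W₁ s * Real.sin t

/-- The real part of the component of `∂Y/∂s` normal to the circle, divided by `e^{iφ}`. -/
def stretch (r W₁ W₂ : ℝ → ℝ) (s t : ℝ) : ℝ := deriv r s + radial W₁ W₂ s t

/-- The imaginary part of the component of `∂Y/∂s` normal to the circle, divided by `e^{iφ}`. -/
def spin (r φ : ℝ → ℝ) (s : ℝ) : ℝ := r s * deriv φ s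

/-- The squared norm of the component of `∂Y/∂s` normal to the circle. -/
def sqSpeed (r φ W₁ W₂ : ℝ → ℝ) (s t : ℝ) : ℝ := stretch r W₁ W₂ s t ^ 2 + spin r φ s ^ 2

/-- `fluxNum` evaluated on a surface of type I. -/
def numer (r φ W₁ W₂ : ℝ → ℝ) (s t : ℝ) : ℝ :=
  fluxNum (r s) (spin r φ s) (deriv (spin r φ) s) (stretch r W₁ W₂ s t)
    (stretch (deriv r) (deriv W₁) (deriv W₂) s t) (tang W₁ W₂ s t)

/-- The `s`-derivative of `numer`. -/
def numerS (r φ W₁ W₂ : ℝ → ℝ) (s t : ℝ) : ℝ :=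
  fluxNumS (r s) (deriv r s) (spin r φ s) (deriv (spin r φ) s) (deriv (deriv (spin r φ)) s)
    (stretch r W₁ W₂ s t) (stretch (deriv r) (deriv W₁) (deriv W₂) s t)
    (stretch (deriv (deriv r)) (deriv (deriv W₁)) (deriv (deriv W₂)) s t) (tang W₁ W₂ s t)
    (tang (deriv W₁) (deriv W₂) s t)

/-- The `t`-derivative of `numer`. -/
def numerT (r φ W₁ W₂ : ℝ → ℝ) (s t : ℝ) : ℝ :=
  fluxNumT (r s) (spin r φ s) (deriv (spin r φ) s) (radial W₁ W₂ s t) (stretch r W₁ W₂ s t)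
    (tang W₁ W₂ s t) (tang (deriv W₁) (deriv W₂) s t)

/-- The flux density of the Lagrangian angle through the circles `s = const`. -/
def flux (r φ W₁ W₂ : ℝ → ℝ) (s t : ℝ) : ℝ :=
  numer r φ W₁ W₂ s t / Real.sqrt (sqSpeed r φ W₁ W₂ s t) ^ 3

/-- Smooth data of a surface of type I over the open interval `I`. -/
structure IsProfile (I : Set ℝ) (r φ W₁ W₂ : ℝ → ℝ) : Prop where
  isOpen : IsOpen I
  ordConnected : I.OrdConnected
  smooth_r : ContDiffOn ℝ ∞ r I
  smooth_φ : ContDiffOn ℝ ∞ φ I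
  smooth_W₁ : ContDiffOn ℝ ∞ W₁ I
  smooth_W₂ : ContDiffOn ℝ ∞ W₂ I
  pos : ∀ s ∈ I, 0 < r s

/-! ### Derivatives of the profile data and of the flux density. -/

section Derivatives

lemma hasDerivAt_radial_t (W₁ W₂ : ℝ → ℝ) (s t : ℝ) :
    HasDerivAt (fun τ => radial W₁ W₂ s τ) (tang W₁ W₂ s t) t := by
  refine (((Real.hasDerivAt_cos t).const_mul (W₁ s)).add
    ((Real.hasDerivAt_sin t).const_mul (W₂ s))).congr_deriv ?_
  simp only [tang]; ring

lemma hasDerivAt_tang_t (W₁ W₂ : ℝ → ℝ) (s t : ℝ) :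
    HasDerivAt (fun τ => tang W₁ W₂ s τ) (-radial W₁ W₂ s t) t := by
  refine (((Real.hasDerivAt_cos t).const_mul (W₂ s)).sub
    ((Real.hasDerivAt_sin t).const_mul (W₁ s))).congr_deriv ?_
  simp only [radial]; ring

lemma hasDerivAt_stretch_t (r W₁ W₂ : ℝ → ℝ) (s t : ℝ) :
    HasDerivAt (fun τ => stretch r W₁ W₂ s τ) (tang W₁ W₂ s t) t :=
  (hasDerivAt_radial_t W₁ W₂ s t).const_add _

lemma hasDerivAt_numer_t (r φ W₁ W₂ : ℝ → ℝ) (s t : ℝ) :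
    HasDerivAt (fun τ => numer r φ W₁ W₂ s τ) (numerT r φ W₁ W₂ s t) t := by
  have ha := hasDerivAt_stretch_t r W₁ W₂ s t
  have ha' := hasDerivAt_stretch_t (deriv r) (deriv W₁) (deriv W₂) s t
  have hv := hasDerivAt_tang_t W₁ W₂ s t
  refine (((((ha.pow 2).add_const (spin r φ s ^ 2)).const_mul (2 * spin r φ s)).add
    (((ha.mul_const (deriv (spin r φ) s)).sub (ha'.const_mul (spin r φ s))).const_mul (r s))).add
    ((hv.pow 2).const_mul (spin r φ s))).congr_deriv ?_
  simp only [numerT, fluxNumT]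
  ring

lemma hasDerivAt_sqSpeed_t (r φ W₁ W₂ : ℝ → ℝ) (s t : ℝ) :
    HasDerivAt (fun τ => sqSpeed r φ W₁ W₂ s τ) (2 * (stretch r W₁ W₂ s t * tang W₁ W₂ s t)) t := by
  refine (((hasDerivAt_stretch_t r W₁ W₂ s t).pow 2).add_const (spin r φ s ^ 2)).congr_deriv ?_
  ring

variable {I : Set ℝ} {r φ W₁ W₂ : ℝ → ℝ} {s : ℝ}

lemma IsProfile.smooth_spin (h : IsProfile I r φ W₁ W₂) : ContDiffOn ℝ ∞ (spin r φ) I :=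
  h.smooth_r.mul (contDiffOn_deriv h.isOpen h.smooth_φ)

lemma hasDerivAt_radial (hI : IsOpen I) (h₁ : ContDiffOn ℝ ∞ W₁ I) (h₂ : ContDiffOn ℝ ∞ W₂ I)
    (hs : s ∈ I) (t : ℝ) :
    HasDerivAt (fun σ => radial W₁ W₂ σ t) (radial (deriv W₁) (deriv W₂) s t) s :=
  ((hasDerivAt_of_contDiffOn hI h₁ hs).mul_const _).add
    ((hasDerivAt_of_contDiffOn hI h₂ hs).mul_const _)

lemma hasDerivAt_tang (hI : IsOpen I) (h₁ : ContDiffOn ℝ ∞ W₁ I) (h₂ : ContDiffOn ℝ ∞ W₂ I)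
    (hs : s ∈ I) (t : ℝ) :
    HasDerivAt (fun σ => tang W₁ W₂ σ t) (tang (deriv W₁) (deriv W₂) s t) s :=
  ((hasDerivAt_of_contDiffOn hI h₂ hs).mul_const _).sub
    ((hasDerivAt_of_contDiffOn hI h₁ hs).mul_const _)

lemma hasDerivAt_stretch (hI : IsOpen I) (hr : ContDiffOn ℝ ∞ r I) (h₁ : ContDiffOn ℝ ∞ W₁ I)
    (h₂ : ContDiffOn ℝ ∞ W₂ I) (hs : s ∈ I) (t : ℝ) :
    HasDerivAt (fun σ => stretch r W₁ W₂ σ t) (stretch (deriv r) (deriv W₁) (deriv W₂) s t) s :=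
  (hasDerivAt_of_contDiffOn hI (contDiffOn_deriv hI hr) hs).add (hasDerivAt_radial hI h₁ h₂ hs t)

lemma IsProfile.hasDerivAt_stretch (h : IsProfile I r φ W₁ W₂) (hs : s ∈ I) (t : ℝ) :
    HasDerivAt (fun σ => stretch r W₁ W₂ σ t) (stretch (deriv r) (deriv W₁) (deriv W₂) s t) s :=
  CyclicLagrangian.hasDerivAt_stretch h.isOpen h.smooth_r h.smooth_W₁ h.smooth_W₂ hs t

lemma IsProfile.hasDerivAt_spin (h : IsProfile I r φ W₁ W₂) (hs : s ∈ I) :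
    HasDerivAt (spin r φ) (deriv (spin r φ) s) s :=
  hasDerivAt_of_contDiffOn h.isOpen h.smooth_spin hs

lemma IsProfile.hasDerivAt_sqSpeed (h : IsProfile I r φ W₁ W₂) (hs : s ∈ I) (t : ℝ) :
    HasDerivAt (fun σ => sqSpeed r φ W₁ W₂ σ t)
      (2 * (stretch r W₁ W₂ s t * stretch (deriv r) (deriv W₁) (deriv W₂) s t +
        spin r φ s * deriv (spin r φ) s)) s := by
  refine (((h.hasDerivAt_stretch hs t).pow 2).add ((h.hasDerivAt_spin hs).pow 2)).congr_deriv ?_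
  ring

lemma IsProfile.hasDerivAt_numer (h : IsProfile I r φ W₁ W₂) (hs : s ∈ I) (t : ℝ) :
    HasDerivAt (fun σ => numer r φ W₁ W₂ σ t) (numerS r φ W₁ W₂ s t) s := by
  have ha := h.hasDerivAt_stretch hs t
  have ha' := CyclicLagrangian.hasDerivAt_stretch h.isOpen (contDiffOn_deriv h.isOpen h.smooth_r)
    (contDiffOn_deriv h.isOpen h.smooth_W₁) (contDiffOn_deriv h.isOpen h.smooth_W₂) hs t
  have hv := hasDerivAt_tang h.isOpen h.smooth_W₁ h.smooth_W₂ hs t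
  have hb := h.hasDerivAt_spin hs
  have hb' := hasDerivAt_of_contDiffOn h.isOpen (contDiffOn_deriv h.isOpen h.smooth_spin) hs
  have hr := hasDerivAt_of_contDiffOn h.isOpen h.smooth_r hs
  refine (((hb.const_mul 2).mul (h.hasDerivAt_sqSpeed hs t)).add
    (hr.mul ((ha.mul hb').sub (hb.mul ha')))).add (hb.mul (hv.pow 2)) |>.congr_deriv ?_
  simp only [numerS, fluxNumS, sqSpeed]
  simp only [Pi.mul_apply, Pi.sub_apply, Pi.pow_apply]
  ring

/-- Shared by the flux density and by `b / A`, which is written over `A³` for this purpose; the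
factor 2 matches the derivative of `a² + b²`. -/
lemma hasDerivAt_div_sqrt_pow_three {f g : ℝ → ℝ} {f' g' x : ℝ} (hf : HasDerivAt f f' x)
    (hg : HasDerivAt g (2 * g') x) (hx : 0 < g x) :
    HasDerivAt (fun y => f y / Real.sqrt (g y) ^ 3)
      ((f' * g x - 3 * f x * g') / Real.sqrt (g x) ^ 5) x := by
  have hA : 0 < Real.sqrt (g x) := Real.sqrt_pos.2 hx
  refine (hf.div ((hg.sqrt hx.ne').pow 3) (pow_pos hA 3).ne').congr_deriv ?_
  have h2 : g x = Real.sqrt (g x) ^ 2 := (Real.sq_sqrt hx.le).symm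
  rw [h2]
  simp only [Real.sqrt_sq hA.le]
  simp only [Pi.pow_apply]
  field_simp
  ring

lemma IsProfile.hasDerivAt_flux (h : IsProfile I r φ W₁ W₂) (hs : s ∈ I) {t : ℝ}
    (hpos : 0 < sqSpeed r φ W₁ W₂ s t) :
    HasDerivAt (fun σ => flux r φ W₁ W₂ σ t)
      ((numerS r φ W₁ W₂ s t * sqSpeed r φ W₁ W₂ s t - 3 * numer r φ W₁ W₂ s t *
        (stretch r W₁ W₂ s t * stretch (deriv r) (deriv W₁) (deriv W₂) s t +
          spin r φ s * deriv (spin r φ) s)) / Real.sqrt (sqSpeed r φ W₁ W₂ s t) ^ 5) s :=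
  hasDerivAt_div_sqrt_pow_three (h.hasDerivAt_numer hs t) (h.hasDerivAt_sqSpeed hs t) hpos

lemma hasDerivAt_flux_t (r φ W₁ W₂ : ℝ → ℝ) {s t : ℝ} (hpos : 0 < sqSpeed r φ W₁ W₂ s t) :
    HasDerivAt (fun τ => flux r φ W₁ W₂ s τ)
      ((numerT r φ W₁ W₂ s t * sqSpeed r φ W₁ W₂ s t - 3 * numer r φ W₁ W₂ s t *
        (stretch r W₁ W₂ s t * tang W₁ W₂ s t)) / Real.sqrt (sqSpeed r φ W₁ W₂ s t) ^ 5) t :=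
  hasDerivAt_div_sqrt_pow_three (hasDerivAt_numer_t r φ W₁ W₂ s t)
    (hasDerivAt_sqSpeed_t r φ W₁ W₂ s t) hpos

end Derivatives

/-! ### First fundamental form and Lagrangian angle of a surface of type I. -/

/-- `Y` is the surface of type I with the given data. -/
structure IsChart (I : Set ℝ) (Y : ℝ → ℝ → C2) (U : C2 ≃ₗᵢ[ℂ] C2) (b : C2) (s₀ : ℝ)
    (r φ W₁ W₂ : ℝ → ℝ) : Prop extends IsProfile I r φ W₁ W₂ where
  base_mem : s₀ ∈ I
  eq : ∀ s ∈ I, ∀ t, Y s t = U (circlePoint (r s) (φ s) t + translationTerm φ W₁ W₂ s₀ s) + b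

variable {I : Set ℝ} {Y : ℝ → ℝ → C2} {U : C2 ≃ₗᵢ[ℂ] C2} {b : C2} {s₀ : ℝ} {r φ W₁ W₂ : ℝ → ℝ}
  {s : ℝ}

namespace IsChart

lemma eq_comb (h : IsChart I Y U b s₀ r φ W₁ W₂) (hs : s ∈ I) (t : ℝ) :
    Y s t = comb U
      (r s * Complex.exp (φ s * Complex.I) * Real.cos t +
        ∫ u in s₀..s, Complex.exp (φ u * Complex.I) * (W₁ u : ℂ))
      (r s * Complex.exp (φ s * Complex.I) * Real.sin t +
        ∫ u in s₀..s, Complex.exp (φ u * Complex.I) * (W₂ u : ℂ)) + b := by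
  rw [h.eq s hs t, comb_eq]
  congr 2
  ext i; fin_cases i <;> simp [circlePoint, translationTerm]

lemma hasDerivAt_t (h : IsChart I Y U b s₀ r φ W₁ W₂) (hs : s ∈ I) (t : ℝ) :
    HasDerivAt (fun τ => Y s τ) (comb U
      (Complex.exp (φ s * Complex.I) * ((-(r s * Real.sin t) : ℝ) : ℂ))
      (Complex.exp (φ s * Complex.I) * ((r s * Real.cos t : ℝ) : ℂ))) t := by
  have hc := (Real.hasDerivAt_cos t).ofReal_comp
  have hsn := (Real.hasDerivAt_sin t).ofReal_comp
  rw [show (fun τ => Y s τ) = _ from funext fun τ => h.eq_comb hs τ]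
  refine (((((hc.const_mul (r s * Complex.exp (φ s * Complex.I))).add_const _).smul_const _).add
    (((hsn.const_mul (r s * Complex.exp (φ s * Complex.I))).add_const _).smul_const
      _)).add_const b).congr_deriv ?_
  simp only [comb]
  congr 2 <;> (push_cast; ring)

lemma continuousOn_integrand (h : IsProfile I r φ W₁ W₂) {W : ℝ → ℝ} (hW : ContDiffOn ℝ ∞ W I) :
    ContinuousOn (fun u => Complex.exp (φ u * Complex.I) * (W u : ℂ)) I := by
  have := h.smooth_φ.continuousOn
  have := hW.continuousOn
  fun_prop

lemma hasDerivAt_s (h : IsChart I Y U b s₀ r φ W₁ W₂) (hs : s ∈ I) (t : ℝ) :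
    HasDerivAt (fun σ => Y σ t) (comb U
      (Complex.exp (φ s * Complex.I) * ((stretch r W₁ W₂ s t + spin r φ s * Complex.I) * Real.cos t -
        tang W₁ W₂ s t * Real.sin t))
      (Complex.exp (φ s * Complex.I) * ((stretch r W₁ W₂ s t + spin r φ s * Complex.I) * Real.sin t +
        tang W₁ W₂ s t * Real.cos t))) s := by
  have hr := (hasDerivAt_of_contDiffOn h.isOpen h.smooth_r hs).ofReal_comp
  have hφ := ((hasDerivAt_of_contDiffOn h.isOpen h.smooth_φ hs).ofReal_comp.mul_const
    Complex.I).cexp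
  have h1 := hasDerivAt_integral h.isOpen h.ordConnected
    (continuousOn_integrand h.toIsProfile h.smooth_W₁) h.base_mem hs
  have h2 := hasDerivAt_integral h.isOpen h.ordConnected
    (continuousOn_integrand h.toIsProfile h.smooth_W₂) h.base_mem hs
  refine HasDerivAt.congr_of_eventuallyEq ?_
    (by filter_upwards [h.isOpen.mem_nhds hs] with σ hσ using h.eq_comb hσ t)
  refine ((((((hr.mul hφ).mul_const _).add h1).smul_const _).add
    ((((hr.mul hφ).mul_const _).add h2).smul_const _)).add_const b).congr_deriv ?_
  simp only [comb]
  have hcs : (Real.sin t : ℂ) ^ 2 + (Real.cos t : ℂ) ^ 2 = 1 := by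
    exact_mod_cast Real.sin_sq_add_cos_sq t
  congr 2
  · simp only [stretch, spin, radial, tang]
    push_cast at hcs ⊢
    linear_combination -Complex.exp (φ s * Complex.I) * W₁ s * hcs
  · simp only [stretch, spin, radial, tang]
    push_cast at hcs ⊢
    linear_combination -Complex.exp (φ s * Complex.I) * W₂ s * hcs

lemma dS_eq (h : IsChart I Y U b s₀ r φ W₁ W₂) (hs : s ∈ I) (t : ℝ) :
    dS Y s t = comb U
      (Complex.exp (φ s * Complex.I) * ((stretch r W₁ W₂ s t + spin r φ s * Complex.I) * Real.cos t -
        tang W₁ W₂ s t * Real.sin t))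
      (Complex.exp (φ s * Complex.I) * ((stretch r W₁ W₂ s t + spin r φ s * Complex.I) * Real.sin t +
        tang W₁ W₂ s t * Real.cos t)) :=
  (h.hasDerivAt_s hs t).deriv

lemma dT_eq (h : IsChart I Y U b s₀ r φ W₁ W₂) (hs : s ∈ I) (t : ℝ) :
    dT Y s t = comb U
      (Complex.exp (φ s * Complex.I) * ((-(r s * Real.sin t) : ℝ) : ℂ))
      (Complex.exp (φ s * Complex.I) * ((r s * Real.cos t : ℝ) : ℂ)) :=
  (h.hasDerivAt_t hs t).deriv

lemma gE_eq (h : IsChart I Y U b s₀ r φ W₁ W₂) (hs : s ∈ I) (t : ℝ) :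
    gE Y s t = sqSpeed r φ W₁ W₂ s t + tang W₁ W₂ s t ^ 2 := by
  rw [gE, h.dS_eq hs, inner_comb U (Complex.norm_exp_ofReal_mul_I _)]
  simp only [Complex.add_re, Complex.sub_re, Complex.mul_re, Complex.ofReal_re, Complex.ofReal_im,
    Complex.add_im, Complex.sub_im, Complex.mul_im, Complex.I_re, Complex.I_im, sqSpeed]
  linear_combination (stretch r W₁ W₂ s t ^ 2 + spin r φ s ^ 2 + tang W₁ W₂ s t ^ 2) *
    Real.sin_sq_add_cos_sq t

lemma gF_eq (h : IsChart I Y U b s₀ r φ W₁ W₂) (hs : s ∈ I) (t : ℝ) :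
    gF Y s t = r s * tang W₁ W₂ s t := by
  rw [gF, h.dS_eq hs, h.dT_eq hs, inner_comb U (Complex.norm_exp_ofReal_mul_I _)]
  simp only [Complex.add_re, Complex.sub_re, Complex.mul_re, Complex.ofReal_re, Complex.ofReal_im,
    Complex.add_im, Complex.sub_im, Complex.mul_im, Complex.I_re, Complex.I_im]
  linear_combination (r s * tang W₁ W₂ s t) * Real.sin_sq_add_cos_sq t

lemma gG_eq (h : IsChart I Y U b s₀ r φ W₁ W₂) (hs : s ∈ I) (t : ℝ) :
    gG Y s t = r s ^ 2 := by
  rw [gG, h.dT_eq hs, inner_comb U (Complex.norm_exp_ofReal_mul_I _)]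
  simp only [Complex.ofReal_re, Complex.ofReal_im]
  linear_combination (r s ^ 2) * Real.sin_sq_add_cos_sq t

lemma areaDensity_eq (h : IsChart I Y U b s₀ r φ W₁ W₂) (hs : s ∈ I) (t : ℝ) :
    areaDensity Y s t = r s * Real.sqrt (sqSpeed r φ W₁ W₂ s t) := by
  rw [areaDensity, h.gE_eq hs, h.gF_eq hs, h.gG_eq hs,
    show (sqSpeed r φ W₁ W₂ s t + tang W₁ W₂ s t ^ 2) * r s ^ 2 - (r s * tang W₁ W₂ s t) ^ 2 =
      r s ^ 2 * sqSpeed r φ W₁ W₂ s t by ring, Real.sqrt_mul (by positivity),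
    Real.sqrt_sq (h.pos s hs).le]

/-- If `a = b = 0`, then `Y_s` is tangent to the circle and `r Y_s - v Y_t = 0`, contrary to the
immersion property. -/
lemma sqSpeed_pos (h : IsChart I Y U b s₀ r φ W₁ W₂) (hImm : IsSmoothImmersion I Y)
    (hs : s ∈ I) (t : ℝ) : 0 < sqSpeed r φ W₁ W₂ s t := by
  refine lt_of_le_of_ne (by unfold sqSpeed; positivity) fun h0 => ?_
  have ha : stretch r W₁ W₂ s t = 0 := by
    unfold sqSpeed at h0; nlinarith [sq_nonneg (stretch r W₁ W₂ s t), sq_nonneg (spin r φ s)]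
  have hb : spin r φ s = 0 := by
    unfold sqSpeed at h0; nlinarith [sq_nonneg (stretch r W₁ W₂ s t), sq_nonneg (spin r φ s)]
  have hli := LinearIndependent.pair_iff.1 (hImm.2.2 s hs t) (r s) (-tang W₁ W₂ s t) ?_
  · exact (h.pos s hs).ne' hli.1
  · rw [h.dS_eq hs, h.dT_eq hs, smul_comb, smul_comb, comb_add, ha, hb]
    have : comb U 0 0 = 0 := by simp [comb]
    rw [← this]
    congr 1 <;> (push_cast; ring)

/-- The Lagrangian angle of a surface of type I. -/
lemma angle_eq (h : IsChart I Y U b s₀ r φ W₁ W₂) (hImm : IsSmoothImmersion I Y) {β : ℝ → ℝ → ℝ}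
    (hβ : IsLagrangianAngle I Y β) (hs : s ∈ I) (t : ℝ) :
    Complex.exp ((β s t - 2 * φ s : ℝ) * Complex.I) * Real.sqrt (sqSpeed r φ W₁ W₂ s t) =
      detC (U !₂[1, 0]) (U !₂[0, 1]) * (stretch r W₁ W₂ s t + spin r φ s * Complex.I) := by
  set A := Real.sqrt (sqSpeed r φ W₁ W₂ s t) with hAdef
  have hpos := h.sqSpeed_pos hImm hs t
  have hA : 0 < A := Real.sqrt_pos.2 hpos
  have hA2 : A ^ 2 = stretch r W₁ W₂ s t ^ 2 + spin r φ s ^ 2 := Real.sq_sqrt hpos.le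
  have hr := h.pos s hs
  have hAC : (A : ℂ) ≠ 0 := by exact_mod_cast hA.ne'
  have hrC : (r s : ℂ) ≠ 0 := by exact_mod_cast hr.ne'
  have hcs := Real.sin_sq_add_cos_sq t
  have hcsC : (Real.sin t : ℂ) ^ 2 + (Real.cos t : ℂ) ^ 2 = 1 := by exact_mod_cast hcs
  set e := Complex.exp (φ s * Complex.I) with he
  set z : ℂ := (stretch r W₁ W₂ s t + spin r φ s * Complex.I) / A with hz
  have hzre : z.re = stretch r W₁ W₂ s t / A := by simp [hz]
  have hzim : z.im = spin r φ s / A := by simp [hz]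
  have hzn : z.re ^ 2 + z.im ^ 2 = 1 := by
    rw [hzre, hzim]; field_simp; exact hA2.symm
  have hframe : IsTangentFrame Y s t (comb U (e * (z * Real.cos t)) (e * (z * Real.sin t)))
      (comb U (e * (-Real.sin t : ℝ)) (e * (Real.cos t : ℝ))) := by
    -- Gram–Schmidt starting from `Y_t`: `e₂ = Y_t / r` and `e₁ = (Y_s - (v / r) Y_t) / A`.
    refine ⟨?_, ?_, ?_, 1 / A, -tang W₁ W₂ s t / (r s * A), 0, 1 / r s, ?_, ?_, ?_⟩
    · rw [inner_comb U (Complex.norm_exp_ofReal_mul_I _)]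
      simp only [Complex.mul_re, Complex.mul_im, Complex.ofReal_re, Complex.ofReal_im]
      linear_combination (Real.sin t ^ 2 + Real.cos t ^ 2) * hzn + hcs
    · rw [inner_comb U (Complex.norm_exp_ofReal_mul_I _)]
      simp only [Complex.ofReal_re, Complex.ofReal_im]
      linear_combination hcs
    · rw [inner_comb U (Complex.norm_exp_ofReal_mul_I _)]
      simp only [Complex.mul_re, Complex.mul_im, Complex.ofReal_re, Complex.ofReal_im]
      ring
    · simp only [mul_zero, sub_zero]; positivity
    · rw [h.dS_eq hs, h.dT_eq hs, smul_comb, smul_comb, comb_add]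
      congr 1 <;>
      · rw [hz, ← he]
        push_cast
        field_simp
        ring
    · rw [h.dS_eq hs, h.dT_eq hs, smul_comb, smul_comb, comb_add]
      congr 1 <;>
      · rw [← he]
        push_cast
        field_simp
        ring
  have hdet := hβ.2 s hs t _ _ hframe
  rw [detC_comb] at hdet
  have hexp : Complex.exp ((β s t - 2 * φ s : ℝ) * Complex.I) * e ^ 2 =
      Complex.exp (β s t * Complex.I) := by
    rw [he, ← Complex.exp_nat_mul, ← Complex.exp_add]
    congr 1; push_cast; ring
  have he0 : e ≠ 0 := Complex.exp_ne_zero _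
  have hzA : z * A = stretch r W₁ W₂ s t + spin r φ s * Complex.I := by
    rw [hz]; field_simp
  rw [← hexp] at hdet
  have h3 : e ^ 2 * (Complex.exp ((β s t - 2 * φ s : ℝ) * Complex.I) -
      detC (U !₂[1, 0]) (U !₂[0, 1]) * z) = 0 := by
    push_cast at hdet hcsC ⊢
    linear_combination -hdet + detC (U !₂[1, 0]) (U !₂[0, 1]) * e ^ 2 * z * hcsC
  have h4 := sub_eq_zero.1 ((mul_eq_zero.1 h3).resolve_left (pow_ne_zero 2 he0))
  rw [h4, ← hzA]; ring

lemma norm_det (h : IsChart I Y U b s₀ r φ W₁ W₂) (hImm : IsSmoothImmersion I Y) {β : ℝ → ℝ → ℝ}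
    (hβ : IsLagrangianAngle I Y β) : ‖detC (U !₂[1, 0]) (U !₂[0, 1])‖ = 1 := by
  have h1 := congrArg norm (h.angle_eq hImm hβ h.base_mem 0)
  have hpos := h.sqSpeed_pos hImm h.base_mem 0
  have hA := Real.sqrt_pos.2 hpos
  rw [norm_mul, norm_mul, Complex.norm_exp_ofReal_mul_I, Complex.norm_add_mul_I,
    Complex.norm_of_nonneg hA.le, one_mul] at h1
  change _ = _ * Real.sqrt (sqSpeed r φ W₁ W₂ s₀ 0) at h1
  exact mul_right_cancel₀ hA.ne' (by rw [one_mul]; exact h1.symm)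

end IsChart

/-! ### From harmonicity of the angle to the vanishing of the defect. -/

lemma IsLagrangianAngle.hasDerivAt_s (hI : IsOpen I) {β : ℝ → ℝ → ℝ}
    (hβ : IsLagrangianAngle I Y β) (hs : s ∈ I) (t : ℝ) :
    HasDerivAt (fun σ => β σ t) (dS β s t) s := by
  have h1 : DifferentiableAt ℝ (fun z : ℝ × ℝ => β z.1 z.2) (s, t) :=
    (hβ.1.contDiffAt ((hI.prod isOpen_univ).mem_nhds ⟨hs, trivial⟩)).differentiableAt (by simp)
  exact (h1.comp (f := fun σ : ℝ => (σ, t)) s (by fun_prop)).hasDerivAt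

lemma IsLagrangianAngle.hasDerivAt_t (hI : IsOpen I) {β : ℝ → ℝ → ℝ}
    (hβ : IsLagrangianAngle I Y β) (hs : s ∈ I) (t : ℝ) :
    HasDerivAt (fun τ => β s τ) (dT β s t) t := by
  have h1 : DifferentiableAt ℝ (fun z : ℝ × ℝ => β z.1 z.2) (s, t) :=
    (hβ.1.contDiffAt ((hI.prod isOpen_univ).mem_nhds ⟨hs, trivial⟩)).differentiableAt (by simp)
  exact (h1.comp (f := fun τ : ℝ => (s, τ)) t (by fun_prop)).hasDerivAt

namespace IsChart

/-- Up to a constant, `β - 2φ` is the argument of `a + ib`. -/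
lemma dS_angle (h : IsChart I Y U b s₀ r φ W₁ W₂) (hImm : IsSmoothImmersion I Y) {β : ℝ → ℝ → ℝ}
    (hβ : IsLagrangianAngle I Y β) (hs : s ∈ I) (t : ℝ) :
    (dS β s t - 2 * deriv φ s) * sqSpeed r φ W₁ W₂ s t =
      stretch r W₁ W₂ s t * deriv (spin r φ) s -
        spin r φ s * stretch (deriv r) (deriv W₁) (deriv W₂) s t := by
  refine deriv_angle (d := detC (U !₂[1, 0]) (U !₂[0, 1])) (f := fun σ => stretch r W₁ W₂ σ t) (g := spin r φ)
    (A := fun σ => Real.sqrt (sqSpeed r φ W₁ W₂ σ t)) (h.hasDerivAt_stretch hs t)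
    (h.hasDerivAt_spin hs) ((hβ.hasDerivAt_s h.isOpen hs t).sub
      ((hasDerivAt_of_contDiffOn h.isOpen h.smooth_φ hs).const_mul 2))
    (Real.sqrt_pos.2 (h.sqSpeed_pos hImm hs t)).ne' ?_
  filter_upwards [h.isOpen.mem_nhds hs] with σ hσ using h.angle_eq hImm hβ hσ t

lemma dT_angle (h : IsChart I Y U b s₀ r φ W₁ W₂) (hImm : IsSmoothImmersion I Y) {β : ℝ → ℝ → ℝ}
    (hβ : IsLagrangianAngle I Y β) (hs : s ∈ I) (t : ℝ) :
    dT β s t * sqSpeed r φ W₁ W₂ s t = -(spin r φ s * tang W₁ W₂ s t) := by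
  have := deriv_angle (f := fun τ => stretch r W₁ W₂ s τ) (g := fun _ => spin r φ s)
    (A := fun τ => Real.sqrt (sqSpeed r φ W₁ W₂ s τ)) (hasDerivAt_stretch_t r W₁ W₂ s t)
    (hasDerivAt_const t _) ((hβ.hasDerivAt_t h.isOpen hs t).sub_const (2 * φ s))
    (Real.sqrt_pos.2 (h.sqSpeed_pos hImm hs t)).ne'
    (Filter.Eventually.of_forall fun τ => h.angle_eq hImm hβ hs τ)
  rw [sqSpeed, this]; ring

lemma flux_s (h : IsChart I Y U b s₀ r φ W₁ W₂) (hImm : IsSmoothImmersion I Y) {β : ℝ → ℝ → ℝ}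
    (hβ : IsLagrangianAngle I Y β) (hs : s ∈ I) (t : ℝ) :
    (gG Y s t * dS β s t - gF Y s t * dT β s t) / areaDensity Y s t = flux r φ W₁ W₂ s t := by
  have hpos := h.sqSpeed_pos hImm hs t
  have hA := Real.sqrt_pos.2 hpos
  have hA2 := Real.sq_sqrt hpos.le
  have h1 := h.dS_angle hImm hβ hs t
  have h2 := h.dT_angle hImm hβ hs t
  have hr := h.pos s hs
  rw [h.gG_eq hs, h.gF_eq hs, h.areaDensity_eq hs, flux, numer, fluxNum,
    div_eq_div_iff (by positivity) (by positivity)]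
  have h3 : spin r φ s = r s * deriv φ s := rfl
  have h4 : stretch r W₁ W₂ s t ^ 2 + spin r φ s ^ 2 = sqSpeed r φ W₁ W₂ s t := rfl
  rw [h4]
  rw [pow_succ _ 2, hA2]
  linear_combination r s * Real.sqrt (sqSpeed r φ W₁ W₂ s t) * (r s * h1 - tang W₁ W₂ s t * h2 -
    2 * sqSpeed r φ W₁ W₂ s t * h3)

/-- Here `β_s` is eliminated in favour of `flux`. The term `b v / A` is kept over `A³` so that
`hasDerivAt_div_sqrt_pow_three` differentiates it. -/
lemma flux_t (h : IsChart I Y U b s₀ r φ W₁ W₂) (hImm : IsSmoothImmersion I Y) {β : ℝ → ℝ → ℝ}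
    (hβ : IsLagrangianAngle I Y β) (hs : s ∈ I) (t : ℝ) :
    (gE Y s t * dT β s t - gF Y s t * dS β s t) / areaDensity Y s t =
      -(spin r φ s * tang W₁ W₂ s t * sqSpeed r φ W₁ W₂ s t /
          Real.sqrt (sqSpeed r φ W₁ W₂ s t) ^ 3 +
        tang W₁ W₂ s t * flux r φ W₁ W₂ s t) / r s := by
  have hpos := h.sqSpeed_pos hImm hs t
  have hA := Real.sqrt_pos.2 hpos
  have hA2 := Real.sq_sqrt hpos.le
  have h2 := h.dT_angle hImm hβ hs t
  have hr := h.pos s hs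
  rw [← h.flux_s hImm hβ hs, h.gE_eq hs, h.gF_eq hs, h.gG_eq hs, h.areaDensity_eq hs,
    pow_succ _ 2, hA2]
  field_simp
  linear_combination h2

/-- The equation of Hamiltonian stationary surfaces of type I. -/
lemma defect_eq_zero (h : IsChart I Y U b s₀ r φ W₁ W₂) (hImm : IsSmoothImmersion I Y)
    (hHam : IsHamiltonianStationary I Y) (hs : s ∈ I) (t : ℝ) :
    defect (r s) (deriv r s) (spin r φ s) (deriv (spin r φ) s) (deriv (deriv (spin r φ)) s)
      (radial W₁ W₂ s t) (stretch r W₁ W₂ s t) (stretch (deriv r) (deriv W₁) (deriv W₂) s t)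
      (stretch (deriv (deriv r)) (deriv (deriv W₁)) (deriv (deriv W₂)) s t) (tang W₁ W₂ s t)
      (tang (deriv W₁) (deriv W₂) s t) = 0 := by
  obtain ⟨β, hβ, hlap⟩ := hHam
  have hpos := h.sqSpeed_pos hImm hs t
  have hA := Real.sqrt_pos.2 hpos
  have hA2 := Real.sq_sqrt hpos.le
  have hr := h.pos s hs
  have h0 := hlap s hs t
  rw [laplacian, div_eq_zero_iff, or_iff_left (by rw [h.areaDensity_eq hs]; positivity)] at h0
  have e1 : dS (fun σ τ => (gG Y σ τ * dS β σ τ - gF Y σ τ * dT β σ τ) / areaDensity Y σ τ) s t =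
      _ := ((h.hasDerivAt_flux hs hpos).congr_of_eventuallyEq (by
        filter_upwards [h.isOpen.mem_nhds hs] with σ hσ using h.flux_s hImm hβ hσ t)).deriv
  have e2 : dT (fun σ τ => (gE Y σ τ * dT β σ τ - gF Y σ τ * dS β σ τ) / areaDensity Y σ τ) s t =
      _ := ((((hasDerivAt_div_sqrt_pow_three
        (((hasDerivAt_tang_t W₁ W₂ s t).const_mul (spin r φ s)).mul
          (hasDerivAt_sqSpeed_t r φ W₁ W₂ s t)) (hasDerivAt_sqSpeed_t r φ W₁ W₂ s t) hpos).add
        ((hasDerivAt_tang_t W₁ W₂ s t).mul (hasDerivAt_flux_t r φ W₁ W₂ hpos))).neg.div_const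
        (r s)).congr_of_eventuallyEq
        (Filter.Eventually.of_forall fun τ => h.flux_t hImm hβ hs τ)).deriv
  rw [e1, e2] at h0
  have hq : stretch r W₁ W₂ s t ^ 2 + spin r φ s ^ 2 = sqSpeed r φ W₁ W₂ s t := rfl
  simp only [defect, hq]
  simp only [flux] at h0
  have hn : numer r φ W₁ W₂ s t = fluxNum (r s) (spin r φ s) (deriv (spin r φ) s)
    (stretch r W₁ W₂ s t) (stretch (deriv r) (deriv W₁) (deriv W₂) s t) (tang W₁ W₂ s t) := rfl
  have hns : numerS r φ W₁ W₂ s t = fluxNumS (r s) (deriv r s) (spin r φ s) (deriv (spin r φ) s)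
    (deriv (deriv (spin r φ)) s) (stretch r W₁ W₂ s t)
    (stretch (deriv r) (deriv W₁) (deriv W₂) s t)
    (stretch (deriv (deriv r)) (deriv (deriv W₁)) (deriv (deriv W₂)) s t) (tang W₁ W₂ s t)
    (tang (deriv W₁) (deriv W₂) s t) := rfl
  have hnt : numerT r φ W₁ W₂ s t = fluxNumT (r s) (spin r φ s) (deriv (spin r φ) s)
    (radial W₁ W₂ s t) (stretch r W₁ W₂ s t) (tang W₁ W₂ s t)
    (tang (deriv W₁) (deriv W₂) s t) := rfl
  rw [← hn, ← hns, ← hnt]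
  simp only [Pi.mul_apply] at h0
  field_simp at h0
  rw [hA2] at h0
  linear_combination h0

lemma numer_eq (h : IsChart I Y U b s₀ r φ W₁ W₂) (hImm : IsSmoothImmersion I Y)
    (hHam : IsHamiltonianStationary I Y) (hs : s ∈ I) (hb : spin r φ s ≠ 0)
    (hK : W₁ s ^ 2 + W₂ s ^ 2 ≠ 0) (t : ℝ) :
    numer r φ W₁ W₂ s t = spin r φ s * sqSpeed r φ W₁ W₂ s t :=
  fluxNum_eq_of_defect (h.pos s hs) hb hK (fun t => h.defect_eq_zero hImm hHam hs t) t

/-- The translation part is constant where the phase of the circles is not. -/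
lemma translation_eq_zero (h : IsChart I Y U b s₀ r φ W₁ W₂) (hImm : IsSmoothImmersion I Y)
    (hHam : IsHamiltonianStationary I Y) (hs : s ∈ I) (hb : spin r φ s ≠ 0) :
    W₁ s ^ 2 + W₂ s ^ 2 = 0 := by
  by_contra hK
  have hnhds := h.isOpen.mem_nhds hs
  have hcK : ContinuousAt (fun σ => W₁ σ ^ 2 + W₂ σ ^ 2) s :=
    ((h.smooth_W₁.continuousOn.continuousAt hnhds).pow 2).add
      ((h.smooth_W₂.continuousOn.continuousAt hnhds).pow 2)
  -- The conditions `b ≠ 0` and `W ≠ 0` are open, so `N = b A²` may be differentiated in `s` as well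
  -- as in `t`.
  have hev : ∀ᶠ σ in nhds s, ∀ t, numer r φ W₁ W₂ σ t = spin r φ σ * sqSpeed r φ W₁ W₂ σ t := by
    filter_upwards [hnhds, (h.hasDerivAt_spin hs).continuousAt.eventually_ne hb,
      hcK.eventually_ne hK] with σ h1 h2 h3 t using h.numer_eq hImm hHam h1 h2 h3 t
  refine false_of_fluxNum_eq (r := r s) hb hK (fun t => h.numer_eq hImm hHam hs hb hK t) fun t => ?_
  have hpos := h.sqSpeed_pos hImm hs t
  have hS := (h.hasDerivAt_numer hs t).unique
    (((h.hasDerivAt_spin hs).mul (h.hasDerivAt_sqSpeed hs t)).congr_of_eventuallyEq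
      (by filter_upwards [hev] with σ hσ using hσ t))
  have hT := (hasDerivAt_numer_t r φ W₁ W₂ s t).unique
    (((hasDerivAt_sqSpeed_t r φ W₁ W₂ s t).const_mul (spin r φ s)).congr_of_eventuallyEq
      (Filter.Eventually.of_forall hev.self_of_nhds))
  have hN := hev.self_of_nhds t
  have hD := h.defect_eq_zero hImm hHam hs t
  simp only [defect] at hD
  unfold numer at hN
  unfold numerS at hS
  unfold numerT at hT
  have hq : stretch r W₁ W₂ s t ^ 2 + spin r φ s ^ 2 = sqSpeed r φ W₁ W₂ s t := rfl
  rw [hN, hS, hT, hq] at hD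
  -- What is left of the defect after inserting `N = b A²` and its two derivatives, once a factor
  -- `A²` is cancelled.
  change r s * stretch r W₁ W₂ s t * (deriv (spin r φ) s * stretch r W₁ W₂ s t -
    spin r φ s * stretch (deriv r) (deriv W₁) (deriv W₂) s t) = -2 * spin r φ s *
    (radial W₁ W₂ s t * sqSpeed r φ W₁ W₂ s t + stretch r W₁ W₂ s t * tang W₁ W₂ s t ^ 2)
  refine mul_left_cancel₀ hpos.ne' ?_
  linear_combination hD + r s * deriv (spin r φ) s * sqSpeed r φ W₁ W₂ s t * hq

lemma spin_eq_zero_near (h : IsChart I Y U b s₀ r φ W₁ W₂) (hImm : IsSmoothImmersion I Y)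
    (hHam : IsHamiltonianStationary I Y) (hs : s ∈ I) (hK : W₁ s ^ 2 + W₂ s ^ 2 ≠ 0) :
    ∀ᶠ σ in nhds s, spin r φ σ = 0 := by
  have hnhds := h.isOpen.mem_nhds hs
  have hcK : ContinuousAt (fun σ => W₁ σ ^ 2 + W₂ σ ^ 2) s :=
    ((h.smooth_W₁.continuousOn.continuousAt hnhds).pow 2).add
      ((h.smooth_W₂.continuousOn.continuousAt hnhds).pow 2)
  filter_upwards [hnhds, hcK.eventually_ne hK] with σ h1 h2
  by_contra hb
  exact h2 (h.translation_eq_zero hImm hHam h1 hb)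

/-- Every term of `fluxNum` contains `b` or `b'`, and both vanish where `b` is locally zero. -/
lemma flux_eq_zero_near (h : IsChart I Y U b s₀ r φ W₁ W₂) (hImm : IsSmoothImmersion I Y)
    (hHam : IsHamiltonianStationary I Y) (hs : s ∈ I) (hK : W₁ s ^ 2 + W₂ s ^ 2 ≠ 0) :
    ∀ᶠ σ in nhds s, flux r φ W₁ W₂ σ 0 = 0 := by
  filter_upwards [(h.spin_eq_zero_near hImm hHam hs hK).eventually_nhds] with σ hσ
  have h1 := hσ.self_of_nhds
  have h2 : deriv (spin r φ) σ = 0 := by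
    rw [Filter.EventuallyEq.deriv_eq (f := fun _ => (0 : ℝ)) hσ]; simp
  simp [flux, numer, fluxNum, h1, h2]

/-- Where `W = 0`, also `w = v = 0`, and the defect reduces to a positive multiple of the
`s`-derivative of the flux. Where `W ≠ 0`, the flux vanishes locally. -/
lemma hasDerivAt_flux_zero (h : IsChart I Y U b s₀ r φ W₁ W₂) (hImm : IsSmoothImmersion I Y)
    (hHam : IsHamiltonianStationary I Y) (hs : s ∈ I) :
    HasDerivAt (fun σ => flux r φ W₁ W₂ σ 0) 0 s := by
  by_cases hK : W₁ s ^ 2 + W₂ s ^ 2 = 0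
  · have h1 : W₁ s = 0 := by nlinarith [sq_nonneg (W₁ s), sq_nonneg (W₂ s)]
    have h2 : W₂ s = 0 := by nlinarith [sq_nonneg (W₁ s), sq_nonneg (W₂ s)]
    refine (h.hasDerivAt_flux hs (h.sqSpeed_pos hImm hs 0)).congr_deriv ?_
    have hD := h.defect_eq_zero hImm hHam hs 0
    have hw : radial W₁ W₂ s 0 = 0 := by simp [radial, h1, h2]
    have hv : tang W₁ W₂ s 0 = 0 := by simp [tang, h1, h2]
    have hr := (h.pos s hs).ne'
    rw [div_eq_zero_iff]
    left
    refine mul_left_cancel₀ hr ?_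
    simp only [defect, hw, hv] at hD
    simp only [numer, numerS, sqSpeed, hv]
    linear_combination hD
  · exact (hasDerivAt_const s (0 : ℝ)).congr_of_eventuallyEq
      (h.flux_eq_zero_near hImm hHam hs hK)

/-- A function satisfying a homogeneous linear equation vanishes identically if it has a zero. -/
lemma eq_zero_of_linear {I : Set ℝ} (hI : IsOpen I) (hc : I.OrdConnected) {f k : ℝ → ℝ}
    (hk : ContinuousOn k I) (hf : ∀ s ∈ I, HasDerivAt f (k s * f s) s) {x y : ℝ} (hx : x ∈ I)
    (hy : y ∈ I) (h0 : f x = 0) : f y = 0 := by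
  have hconst := eq_of_forall_hasDerivAt_zero hI hc
    (f := fun s => f s * Real.exp (-∫ u in x..s, k u)) (fun s hs => by
      refine ((hf s hs).mul (hasDerivAt_integral hI hc hk hx hs).neg.exp).congr_deriv ?_
      ring) hx hy
  simp only [h0, zero_mul] at hconst
  exact (mul_eq_zero.1 hconst.symm).resolve_right (Real.exp_ne_zero _)

/-- Always `(b / A)' = a (a b' - b a') / A³`, and `N = 0` gives `r (a b' - b a') = -b (2A² + v²)`.
So `b / A` solves a homogeneous linear ODE, whose coefficient is `k` below. -/
lemma spin_dichotomy (h : IsChart I Y U b s₀ r φ W₁ W₂) (hImm : IsSmoothImmersion I Y)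
    (hflux : ∀ s ∈ I, flux r φ W₁ W₂ s 0 = 0) {x : ℝ} (hx : x ∈ I) (h0 : spin r φ x = 0) :
    ∀ s ∈ I, spin r φ s = 0 := by
  have hA : ∀ s ∈ I, 0 < Real.sqrt (sqSpeed r φ W₁ W₂ s 0) := fun s hs =>
    Real.sqrt_pos.2 (h.sqSpeed_pos hImm hs 0)
  have hcont : ∀ s ∈ I, ContinuousAt (fun σ => sqSpeed r φ W₁ W₂ σ 0) s := fun s hs =>
    (h.hasDerivAt_sqSpeed hs 0).continuousAt
  have hlin := fun s hs => eq_zero_of_linear h.isOpen h.ordConnected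
    (f := fun σ => spin r φ σ * sqSpeed r φ W₁ W₂ σ 0 / Real.sqrt (sqSpeed r φ W₁ W₂ σ 0) ^ 3)
    (k := fun σ => -(stretch r W₁ W₂ σ 0 * (2 * sqSpeed r φ W₁ W₂ σ 0 + tang W₁ W₂ σ 0 ^ 2)) /
      (r σ * sqSpeed r φ W₁ W₂ σ 0)) (x := x) (y := s)
    (fun s hs => by
      have := hcont s hs
      have h1 := (h.hasDerivAt_stretch hs 0).continuousAt
      have h2 := (hasDerivAt_tang h.isOpen h.smooth_W₁ h.smooth_W₂ hs 0).continuousAt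
      have h3 := (hasDerivAt_of_contDiffOn h.isOpen h.smooth_r hs).continuousAt
      refine ContinuousAt.continuousWithinAt (ContinuousAt.div ?_ (h3.mul this)
        (mul_pos (h.pos s hs) (h.sqSpeed_pos hImm hs 0)).ne')
      fun_prop)
    (fun s hs => by
      have hpos := h.sqSpeed_pos hImm hs 0
      have hA := Real.sqrt_pos.2 hpos
      have hA2 := Real.sq_sqrt hpos.le
      have hr := h.pos s hs
      refine (hasDerivAt_div_sqrt_pow_three ((h.hasDerivAt_spin hs).mul (h.hasDerivAt_sqSpeed hs 0))
        (h.hasDerivAt_sqSpeed hs 0) hpos).congr_deriv ?_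
      have hN : numer r φ W₁ W₂ s 0 = 0 := by
        have := hflux s hs
        rw [flux, div_eq_zero_iff] at this
        exact this.resolve_right (by positivity)
      have hq : stretch r W₁ W₂ s 0 ^ 2 + spin r φ s ^ 2 = sqSpeed r φ W₁ W₂ s 0 := rfl
      simp only [numer, fluxNum, hq] at hN
      simp only [Pi.mul_apply]
      field_simp
      rw [hA2]
      linear_combination stretch r W₁ W₂ s 0 * sqSpeed r φ W₁ W₂ s 0 * hN -
        r s * deriv (spin r φ) s * sqSpeed r φ W₁ W₂ s 0 * hq) hx hs (by simp [h0])
  intro s hs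
  have := hlin s hs
  have hpos := h.sqSpeed_pos hImm hs 0
  have hA := hA s hs
  rw [div_eq_zero_iff, or_iff_left (by positivity)] at this
  exact (mul_eq_zero.1 this).resolve_right hpos.ne'

end IsChart

/-! ### Arc length reparametrization and the conclusion. -/

/-- A smooth function with positive derivative on an open interval has a smooth inverse. -/
lemma exists_smooth_inverse {I : Set ℝ} (hI : IsOpen I) (hc : I.OrdConnected) {l A : ℝ → ℝ}
    (hA : ContDiffOn ℝ ∞ A I) (hpos : ∀ s ∈ I, 0 < A s) (hl : ∀ s ∈ I, HasDerivAt l (A s) s) :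
    ∃ (J : Set ℝ) (ψ : ℝ → ℝ), IsOpen J ∧ J.OrdConnected ∧ ContDiffOn ℝ ∞ ψ J ∧
      Set.BijOn ψ J I ∧ ∀ σ ∈ J, HasDerivAt ψ (A (ψ σ))⁻¹ σ := by
  have hderiv : Set.EqOn (deriv l) A I := fun s hs => (hl s hs).deriv
  have hlcont : ContinuousOn l I := fun s hs => (hl s hs).continuousAt.continuousWithinAt
  have hlsm : ContDiffOn ℝ ∞ l I := (contDiffOn_infty_iff_deriv_of_isOpen hI).2
    ⟨fun s hs => (hl s hs).differentiableAt.differentiableWithinAt, hA.congr hderiv⟩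
  have hmono : StrictMonoOn l I := strictMonoOn_of_deriv_pos hc.convex hlcont
    fun s hs => by rw [hI.interior_eq] at hs; rw [hderiv hs]; exact hpos s hs
  have hstrict : ∀ s ∈ I, HasStrictDerivAt l (A s) s := fun s hs =>
    (hlsm.contDiffAt (hI.mem_nhds hs)).hasStrictDerivAt' (hl s hs) (by simp)
  set ψ := Function.invFunOn l I with hψ
  have hleft : ∀ s ∈ I, ψ (l s) = s := fun s hs => hmono.injOn.leftInvOn_invFunOn hs
  have hopen : IsOpen (l '' I) := by
    rw [isOpen_iff_mem_nhds]
    rintro _ ⟨s, hs, rfl⟩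
    rw [← (hstrict s hs).map_nhds_eq (hpos s hs).ne']
    exact Filter.image_mem_map (hI.mem_nhds hs)
  have hbij : Set.BijOn ψ (l '' I) I := by
    refine ⟨?_, ?_, ?_⟩
    · rintro _ ⟨s, hs, rfl⟩; rw [hleft s hs]; exact hs
    · rintro _ ⟨s, hs, rfl⟩ _ ⟨u, hu, rfl⟩ hsu
      rw [hleft s hs, hleft u hu] at hsu; rw [hsu]
    · intro s hs; exact ⟨l s, ⟨s, hs, rfl⟩, hleft s hs⟩
  have hψd : ∀ σ ∈ l '' I, HasDerivAt ψ (A (ψ σ))⁻¹ σ := by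
    rintro _ ⟨s, hs, rfl⟩
    rw [hleft s hs]
    refine ((hstrict s hs).to_local_left_inverse (hpos s hs).ne' ?_).hasDerivAt
    filter_upwards [hI.mem_nhds hs] with u hu using hleft u hu
  refine ⟨l '' I, ψ, hopen, (hc.isPreconnected.image l hlcont).ordConnected, ?_, hbij, hψd⟩
  rw [contDiffOn_infty]
  intro n
  -- Bootstrapping: `ψ' = 1 / A(ψ)` gains one derivative at each step.
  induction n with
  | zero =>
    exact contDiffOn_zero.2 fun σ hσ => (hψd σ hσ).continuousAt.continuousWithinAt
  | succ n ih =>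
    push_cast
    rw [contDiffOn_succ_iff_deriv_of_isOpen hopen]
    refine ⟨fun σ hσ => (hψd σ hσ).differentiableAt.differentiableWithinAt, by simp, ?_⟩
    have hAn : ContDiffOn ℝ n A I := hA.of_le (by exact_mod_cast le_top)
    exact ((hAn.comp ih hbij.mapsTo).inv fun σ hσ => (hpos _ (hbij.mapsTo hσ)).ne').congr
      fun σ hσ => (hψd σ hσ).deriv

namespace IsChart

/-- Since `r > 0`, the phase `φ` is constant, and `Y - b` is a real combination of the two vectors
`U(e^{iφ}, 0)` and `U(0, e^{iφ})`. -/
lemma isPlanar (h : IsChart I Y U b s₀ r φ W₁ W₂) (h0 : ∀ s ∈ I, spin r φ s = 0) :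
    IsPlanar I Y := by
  have hφ : ∀ s ∈ I, φ s = φ s₀ := fun s hs =>
    eq_of_forall_hasDerivAt_zero h.isOpen h.ordConnected (fun u hu => by
      have := (mul_eq_zero.1 (h0 u hu)).resolve_left (h.pos u hu).ne'
      rw [← this]
      exact hasDerivAt_of_contDiffOn h.isOpen h.smooth_φ hu) hs h.base_mem
  set e := Complex.exp (φ s₀ * Complex.I) with he
  have he0 : e ≠ 0 := Complex.exp_ne_zero _
  have hint : ∀ s ∈ I, ∀ W : ℝ → ℝ, (∫ u in s₀..s, Complex.exp (φ u * Complex.I) * (W u : ℂ)) =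
      e * (∫ u in s₀..s, W u : ℝ) := by
    intro s hs W
    rw [← intervalIntegral.integral_ofReal, ← intervalIntegral.integral_const_mul]
    refine intervalIntegral.integral_congr fun u hu => ?_
    simp only [hφ u (h.ordConnected.uIcc_subset h.base_mem hs hu), he]
  have hli : LinearIndependent ℝ ![comb U e 0, comb U 0 e] := by
    rw [LinearIndependent.pair_iff]
    intro x y hxy
    rw [smul_comb, smul_comb, comb_add, comb_eq] at hxy
    have h1 := (LinearIsometryEquiv.map_eq_zero_iff U).1 hxy
    have hx := congrArg (fun z : C2 => z 0) h1
    have hy := congrArg (fun z : C2 => z 1) h1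
    simp [he0] at hx hy
    exact ⟨hx, hy⟩
  refine ⟨AffineSubspace.mk' b (Submodule.span ℝ (Set.range ![comb U e 0, comb U 0 e])), ?_, ?_⟩
  · rw [AffineSubspace.direction_mk', finrank_span_eq_card hli]; simp
  · intro s hs t
    rw [AffineSubspace.mem_mk', h.eq_comb hs, hφ s hs, hint s hs, hint s hs, vsub_eq_sub,
      add_sub_cancel_right]
    have : comb U (r s * e * Real.cos t + e * (∫ u in s₀..s, W₁ u : ℝ))
        (r s * e * Real.sin t + e * (∫ u in s₀..s, W₂ u : ℝ)) =
        (r s * Real.cos t + ∫ u in s₀..s, W₁ u) • comb U e 0 +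
        (r s * Real.sin t + ∫ u in s₀..s, W₂ u) • comb U 0 e := by
      rw [smul_comb, smul_comb, comb_add]
      congr 1 <;> (push_cast; ring)
    rw [this]
    exact add_mem (Submodule.smul_mem _ _ (Submodule.subset_span ⟨0, rfl⟩))
      (Submodule.smul_mem _ _ (Submodule.subset_span ⟨1, rfl⟩))

lemma exists_flux_eq (h : IsChart I Y U b s₀ r φ W₁ W₂) (hImm : IsSmoothImmersion I Y)
    (hHam : IsHamiltonianStationary I Y) : ∃ C, ∀ s ∈ I, flux r φ W₁ W₂ s 0 = C :=
  ⟨flux r φ W₁ W₂ s₀ 0, fun _ hs => eq_of_forall_hasDerivAt_zero h.isOpen h.ordConnected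
    (fun _ hu => h.hasDerivAt_flux_zero hImm hHam hu) hs h.base_mem⟩

/-- One point with `W ≠ 0` makes the constant flux zero and provides a zero of `b`; by
`spin_dichotomy` this propagates to all of `I`. -/
lemma translation_eq_zero_of_not_isPlanar (h : IsChart I Y U b s₀ r φ W₁ W₂)
    (hImm : IsSmoothImmersion I Y) (hHam : IsHamiltonianStationary I Y) (hpl : ¬ IsPlanar I Y) :
    ∀ s ∈ I, W₁ s = 0 ∧ W₂ s = 0 := by
  intro s hs
  have hK : W₁ s ^ 2 + W₂ s ^ 2 = 0 := by
    by_contra hK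
    obtain ⟨C, hC⟩ := h.exists_flux_eq hImm hHam
    have hC0 : C = 0 := by
      rw [← hC s hs, (h.flux_eq_zero_near hImm hHam hs hK).self_of_nhds]
    subst hC0
    exact hpl (h.isPlanar (h.spin_dichotomy hImm hC hs
      (h.spin_eq_zero_near hImm hHam hs hK).self_of_nhds))
  constructor <;> nlinarith [sq_nonneg (W₁ s), sq_nonneg (W₂ s)]

lemma eq_circle (h : IsChart I Y U b s₀ r φ W₁ W₂) (hW : ∀ s ∈ I, W₁ s = 0 ∧ W₂ s = 0)
    (hs : s ∈ I) (t : ℝ) : Y s t = U (circlePoint (r s) (φ s) t) + b := by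
  have hint : ∀ W : ℝ → ℝ, (∀ u ∈ I, W u = 0) →
      (∫ u in s₀..s, Complex.exp (φ u * Complex.I) * (W u : ℂ)) = 0 := by
    intro W hW
    rw [← intervalIntegral.integral_zero (a := s₀) (b := s) (μ := MeasureTheory.volume) (E := ℂ)]
    refine intervalIntegral.integral_congr fun u hu => ?_
    simp [hW u (h.ordConnected.uIcc_subset h.base_mem hs hu)]
  have : translationTerm φ W₁ W₂ s₀ s = 0 := by
    rw [translationTerm, hint W₁ fun u hu => (hW u hu).1, hint W₂ fun u hu => (hW u hu).2]
    ext i; fin_cases i <;> simp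
  rw [h.eq s hs, this, add_zero]

lemma isCentered (h : IsChart I Y U b s₀ r φ W₁ W₂) (hW : ∀ s ∈ I, W₁ s = 0 ∧ W₂ s = 0) :
    IsCentered I Y := by
  refine ⟨b, fun s hs => ⟨r s, comb U (Complex.exp (φ s * Complex.I) * 1)
    (Complex.exp (φ s * Complex.I) * 0), comb U (Complex.exp (φ s * Complex.I) * 0)
    (Complex.exp (φ s * Complex.I) * 1), h.pos s hs, ?_, ?_, ?_, fun t => ?_⟩⟩
  · rw [inner_comb U (Complex.norm_exp_ofReal_mul_I _)]; simp
  · rw [inner_comb U (Complex.norm_exp_ofReal_mul_I _)]; simp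
  · rw [inner_comb U (Complex.norm_exp_ofReal_mul_I _)]; simp
  · rw [h.eq_circle hW hs, smul_comb, smul_comb, comb_add, smul_comb, comb_eq, add_comm]
    congr 2
    ext i; fin_cases i <;> (simp [circlePoint]; ring)

lemma isCenteredExample (h : IsChart I Y U b s₀ r φ W₁ W₂) (hImm : IsSmoothImmersion I Y)
    (hHam : IsHamiltonianStationary I Y) (hW : ∀ s ∈ I, W₁ s = 0 ∧ W₂ s = 0) :
    IsCenteredExample I Y := by
  obtain ⟨C, hC⟩ := h.exists_flux_eq hImm hHam
  obtain ⟨β, hβ, -⟩ := hHam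
  set A : ℝ → ℝ := fun s => Real.sqrt (sqSpeed r φ W₁ W₂ s 0) with hAdef
  have hpos : ∀ s ∈ I, 0 < sqSpeed r φ W₁ W₂ s 0 := fun s hs => h.sqSpeed_pos hImm hs 0
  have hA : ∀ s ∈ I, 0 < A s := fun s hs => Real.sqrt_pos.2 (hpos s hs)
  have hAsm : ContDiffOn ℝ ∞ A I := by
    refine ContDiffOn.sqrt ?_ fun s hs => (hpos s hs).ne'
    have h1 := contDiffOn_deriv h.isOpen h.smooth_r
    have h2 := h.smooth_spin
    have h3 := h.smooth_W₁
    have h4 := h.smooth_W₂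
    unfold sqSpeed stretch radial
    fun_prop
  -- With `W = 0`, `A` is the speed `|r' + i r φ'|` of the curve `r e^{iφ}`, so `ψ` inverts its arc
  -- length.
  obtain ⟨J, ψ, hJo, hJc, hψ, hbij, hψd⟩ := exists_smooth_inverse h.isOpen h.ordConnected hAsm hA
    (fun s hs => hasDerivAt_integral h.isOpen h.ordConnected hAsm.continuousOn h.base_mem hs)
  set d := detC (U !₂[1, 0]) (U !₂[0, 1]) with hd
  have hdn : ‖d‖ = 1 := h.norm_det hImm hβ
  have hdexp : Complex.exp (d.arg * Complex.I) = d := by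
    have := Complex.norm_mul_exp_arg_mul_I d
    rwa [hdn, Complex.ofReal_one, one_mul] at this
  have hd0 : d ≠ 0 := norm_ne_zero_iff.1 (by rw [hdn]; exact one_ne_zero)
  -- The smooth angle `β` supplies a smooth branch of `α = arg (r' + i r φ')`; subtracting `d.arg`
  -- removes the constant phase coming from `U`.
  have hangle : ∀ s ∈ I, A s * Real.cos (β s 0 - 2 * φ s - d.arg) = deriv r s ∧
      A s * Real.sin (β s 0 - 2 * φ s - d.arg) = spin r φ s := by
    intro s hs
    have h1 := h.angle_eq hImm hβ hs 0
    have hst : stretch r W₁ W₂ s 0 = deriv r s := by simp [stretch, radial, hW s hs]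
    rw [hst] at h1
    have h2 : Complex.exp ((β s 0 - 2 * φ s - d.arg : ℝ) * Complex.I) * d =
        Complex.exp ((β s 0 - 2 * φ s : ℝ) * Complex.I) := by
      nth_rewrite 2 [← hdexp]
      rw [← Complex.exp_add]
      congr 1; push_cast; ring
    rw [← h2] at h1
    have h3 : (A s : ℂ) * Complex.exp ((β s 0 - 2 * φ s - d.arg : ℝ) * Complex.I) =
        deriv r s + spin r φ s * Complex.I :=
      mul_left_cancel₀ hd0 (by rw [← h1]; ring)
    have hre := congrArg Complex.re h3
    have him := congrArg Complex.im h3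
    rw [Complex.re_ofReal_mul, Complex.exp_ofReal_mul_I_re] at hre
    rw [Complex.im_ofReal_mul, Complex.exp_ofReal_mul_I_im] at him
    exact ⟨by simpa using hre, by simpa using him⟩
  refine ⟨C, J, ψ, fun σ => r (ψ σ), fun σ => φ (ψ σ),
    fun σ => β (ψ σ) 0 - 2 * φ (ψ σ) - d.arg, U, b, hJo, hJc, hψ, hbij, fun σ hσ => ?_,
    fun σ hσ t => h.eq_circle hW (hbij.mapsTo hσ) t⟩
  have hs := hbij.mapsTo hσ
  have hAs := hA _ hs
  have hrs := h.pos _ hs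
  have hr := hasDerivAt_of_contDiffOn h.isOpen h.smooth_r hs
  have hφ := hasDerivAt_of_contDiffOn h.isOpen h.smooth_φ hs
  have hβs := hβ.hasDerivAt_s h.isOpen hs 0
  obtain ⟨hcos, hsin⟩ := hangle _ hs
  refine ⟨by rw [(hψd σ hσ).deriv]; positivity, hrs, ?_, ?_, ?_⟩
  · refine (hr.comp σ (hψd σ hσ)).congr_deriv ?_
    rw [← hcos]; field_simp
  · refine (hφ.comp σ (hψd σ hσ)).congr_deriv ?_
    unfold spin at hsin
    field_simp
    linear_combination -hsin
  · refine (((hβs.sub (hφ.const_mul 2)).sub_const d.arg).comp σ (hψd σ hσ)).congr_deriv ?_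
    have hF := hC _ hs
    rw [flux, div_eq_iff (pow_ne_zero 3 hAs.ne')] at hF
    have h1 := h.dS_angle hImm hβ hs 0
    have hA2 : A (ψ σ) ^ 2 = sqSpeed r φ W₁ W₂ (ψ σ) 0 := Real.sq_sqrt (hpos _ hs).le
    have hv : tang W₁ W₂ (ψ σ) 0 = 0 := by simp [tang, hW _ hs]
    have hq : stretch r W₁ W₂ (ψ σ) 0 ^ 2 + spin r φ (ψ σ) ^ 2 = sqSpeed r φ W₁ W₂ (ψ σ) 0 := rfl
    change _ = C * A (ψ σ) ^ 3 at hF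
    simp only [numer, fluxNum, hv, hq] at hF
    rw [← hA2] at h1 hF
    field_simp
    refine mul_left_cancel₀ (pow_ne_zero 2 hAs.ne') ?_
    -- With `v = 0` and `b = A sin α`, the equation `N = C A³` reads `2 A³ sin α + r A² α_s = C A³`.
    linear_combination r (ψ σ) * h1 + hF + 2 * A (ψ σ) ^ 2 * hsin

end IsChart

end CyclicLagrangian

end

theorem mainTheorem4 (I : Set ℝ) (hIopen : IsOpen I) (hIconn : I.OrdConnected)
    (Y : ℝ → ℝ → CyclicLagrangian.C2)
    (hImm : CyclicLagrangian.IsSmoothImmersion I Y)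
    (hLag : CyclicLagrangian.IsLagrangian I Y)
    (hType : CyclicLagrangian.IsTypeI I Y)
    (hHam : CyclicLagrangian.IsHamiltonianStationary I Y)
    (hPlanar : ¬ CyclicLagrangian.IsPlanar I Y) :
    CyclicLagrangian.IsCentered I Y ∧ CyclicLagrangian.IsCenteredExample I Y := by
  obtain ⟨U, b, s₀, r, φ, W₁, W₂, hs₀, hr, hφ, hW₁, hW₂, hpos, hY⟩ := hType
  have h : CyclicLagrangian.IsChart I Y U b s₀ r φ W₁ W₂ :=
    ⟨⟨hIopen, hIconn, hr, hφ, hW₁, hW₂, hpos⟩, hs₀, hY⟩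
  have hW := h.translation_eq_zero_of_not_isPlanar hImm hHam hPlanar
  exact ⟨h.isCentered hW, h.isCenteredExample hImm hHam hW⟩
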